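/- **Setting.** A concept class $C$ over a measurable space $X$ is a set of measurable subsets of $X$; it is assumed to be universally separable (some countable $C_0\subseteq C$ is such that every $c\in C$ is a pointwise limit of a sequence in $C_0$; this is automatic if $X$ is countable). A learner is a randomized algorithm that in each step performs an internal computation, draws a labelled example $(x,c^*(x))$, or makes a uniformly random choice from a finite set, and that finally outputs a concept or gives up. A PAC-learner for $C$ is a family $A(\varepsilon,\delta)$ of learners with outputs in $C$ such that, for all $\varepsilon,\delta\in(0,1)$, every distribution $D$ on $X$ and every target $c^*\in C$, with probability at least $1-\delta$ it outputs $c$ with $D(c\,\triangle\, c^*)\le\varepsilon$. Its running time, also written $A(\varepsilon,\delta)$, is the maximal number of steps over all runs. Let $C_1\times C_2$ denote the class $\{c_1\times c_2: c_1\in C_1,\ c_2\in C_2\}$ over $X_1\times X_2$. A *black-box procedure* knows the domains and classes only through the following operations: draw a labelled example of the target in $X_1\times X_2$ (one step); evaluate an already obtained concept of $C_i$ on the $i$-th coordinate of an already drawn point (one step); run the sublearner $A_i$ with chosen parameters on examples drawn uniformly from a chosen nonempty list of labelled $i$-th coordinates of drawn points (one step per list entry, plus all the steps of $A_i$); stop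 with a product $c_1\times c_2$ of obtained concepts, or give up (one step). Its choices depend only on the parameters and on the answers received; the choice of the next operation is not charged. **Theorem.** There are absolute constants $b>0$ and $K\in\mathbb N$, $K\geq 1$, and a black-box procedure depending only on $d_1,d_2\in\mathbb{N}$ and $\varepsilon,\delta\in(0,1)$, such that the following holds. Let $C_1$ and $C_2$ be concept classes of VC-dimension $d_1$ and $d_2$, with PAC-learners $A_1$ and $A_2$. Then the procedure, run with the sublearners $A_1,A_2$, is a PAC-learner for $C_1\times C_2$. For all $\varepsilon,\delta\in(0,1)$ it draws at most $$m=\left\lceil b\,\frac{(d_1+d_2)\log(2/\varepsilon)+\log(2/\delta)}{\varepsilon}\right\rceil$$ examples, and, with $\delta'=\delta/(K m^{\max(d_1,1)})$, its running time is at most $$K\,m^{\max(d_1,1)}\bigl(A_1(1/m,\delta')+A_2(1/m,\delta')\bigr).$$ Moreover it is an empirical risk minimizer: for every sequence of examples labelled by a concept of $C_1\times C_2$, with probability at least $1-\delta$ over its internal randomness, it outputs a concept of $C_1\times C_2$ that misclassifies none of the examples it has drawn. -/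

import Mathlib

open scoped ENNReal

noncomputable section

namespace ModularPAC

universe u v w

/-! Concept classes. A concept over `X` is a subset of `X`, a concept class is a set of concepts. -/

/-- `C` shatters the finite set `s`: every subset of `s` is cut out by some concept of `C`. -/
def Shatters {X : Type u} (C : Set (Set X)) (s : Finset X) : Prop :=
  ∀ t : Set X, t ⊆ (s : Set X) → ∃ c ∈ C, (s : Set X) ∩ c = t

/-- The VC-dimension of a concept class. -/
def vcDim {X : Type u} (C : Set (Set X)) : ℕ∞ :=
  ⨆ s : {s : Finset X // Shatters C s}, (s.1.card : ℕ∞)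

/-- The class of all products `c₁ × c₂` with `c₁ ∈ C₁` and `c₂ ∈ C₂`. -/
def prodClass {X₁ : Type u} {X₂ : Type v} (C₁ : Set (Set X₁)) (C₂ : Set (Set X₂)) :
    Set (Set (X₁ × X₂)) :=
  {c | ∃ c₁ ∈ C₁, ∃ c₂ ∈ C₂, c = c₁ ×ˢ c₂}

/-- The usual measurability convention on a concept class: all concepts are measurable, and
some countable subclass is pointwise sequentially dense (the class is universally separable).
The second part holds for every class over a countable domain. -/
structure WellBehaved {X : Type u} [MeasurableSpace X] (C : Set (Set X)) : Prop where
  measurable : ∀ c ∈ C, MeasurableSet c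
  separable : ∃ C₀ ⊆ C, C₀.Countable ∧ ∀ c ∈ C, ∃ s : ℕ → Set X, (∀ n, s n ∈ C₀) ∧
    ∀ x, ∀ᶠ n in Filter.atTop, (x ∈ s n ↔ x ∈ c)

/-! Learning algorithms with a step count. -/

/-- A randomized learning algorithm over `X` that outputs a hypothesis from `H` or gives up,
presented as the tree of its possible runs:
* `ret o` stops with output `o` (`none` is "no hypothesis");
* `tick A` makes one step of internal computation;
* `draw k` asks the example oracle `EX` for a labelled example `(x, b)` and goes on with `k x b`;
* `rand n k` draws a uniformly random `i` from `n + 1` values and goes on with `k i`. -/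
inductive Learner (X : Type u) (H : Type v) : Type (max u v)
  | ret (o : Option H) : Learner X H
  | tick (A : Learner X H) : Learner X H
  | draw (k : X → Bool → Learner X H) : Learner X H
  | rand (n : ℕ) (k : Fin (n + 1) → Learner X H) : Learner X H

namespace Learner

variable {X : Type u} {H : Type v}

/-- Worst-case running time: the largest number of steps over all runs (all examples, all
labels, all random choices). -/
def time : Learner X H → ℕ∞
  | ret _ => 1
  | tick A => 1 + A.time
  | draw k => 1 + ⨆ x, ⨆ b, (k x b).time
  | rand _ k => 1 + ⨆ i, (k i).time

/-- Worst-case number of examples that are drawn from the example oracle. -/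
def draws : Learner X H → ℕ∞
  | ret _ => 0
  | tick A => A.draws
  | draw k => 1 + ⨆ x, ⨆ b, (k x b).draws
  | rand _ k => ⨆ i, (k i).draws

open Classical in
/-- The probability that the algorithm outputs a hypothesis with property `G`, when the
example oracle draws `x` from `D`, independently each time, and labels it by the target `c`.
(For a function that is not measurable, `∫⁻` is the lower integral.) -/
def successProb [MeasurableSpace X] (D : MeasureTheory.Measure X) (c : Set X) (G : H → Prop) :
    Learner X H → ℝ≥0∞
  | ret none => 0
  | ret (some h) => if G h then 1 else 0
  | tick A => A.successProb D c G
  | draw k => ∫⁻ x, (k x (decide (x ∈ c))).successProb D c G ∂D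
  | rand n k => (∑ i, (k i).successProb D c G) / ((n + 1 : ℕ) : ℝ≥0∞)

open Classical in
/-- The probability, over the internal randomness only, that the algorithm outputs a hypothesis
`h` with `G N h`, where `N` is the total number of examples drawn, when the successive examples
are `x 0, x 1, …` labelled by the target `c` and `t` of them have been drawn already. -/
def successProbOn (x : ℕ → X) (c : Set X) (G : ℕ → H → Prop) : Learner X H → ℕ → ℝ≥0∞
  | ret none, _ => 0
  | ret (some h), t => if G t h then 1 else 0
  | tick A, t => A.successProbOn x c G t
  | draw k, t => (k (x t) (decide (x t ∈ c))).successProbOn x c G (t + 1)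
  | rand n k, t => (∑ i, (k i).successProbOn x c G t) / ((n + 1 : ℕ) : ℝ≥0∞)

/-- Run the algorithm step by step with its example oracle replaced by uniformly random draws
from the `n + 1` labelled examples `e 0, …, e n`, and pass its output to `k`. -/
def simulate {Y : Type w} {H' : Type*} (n : ℕ) (e : Fin (n + 1) → X × Bool)
    (k : Option H → Learner Y H') : Learner X H → Learner Y H'
  | ret o => tick (k o)
  | tick A => tick (A.simulate n e k)
  | draw f => rand n fun i => (f (e i).1 (e i).2).simulate n e k
  | rand r f => rand r fun i => (f i).simulate n e k

end Learner

/-- `A` is a (proper) PAC-learner for `C`: for every distribution `D`, every target `c ∈ C` and all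
`ε, δ ∈ (0, 1)`, the algorithm `A ε δ` outputs, with probability at least `1 - δ`, a concept of `C`
whose error `D {x | h x ≠ c x}` is at most `ε`. -/
def IsPACLearner {X : Type u} [MeasurableSpace X] (C : Set (Set X))
    (A : ℝ → ℝ → Learner X C) : Prop :=
  ∀ ε δ : ℝ, 0 < ε → ε < 1 → 0 < δ → δ < 1 →
    ∀ D : MeasureTheory.Measure X, MeasureTheory.IsProbabilityMeasure D → ∀ c ∈ C,
      ENNReal.ofReal (1 - δ) ≤
        (A ε δ).successProb D c fun h => D (symmDiff h.1 c) ≤ ENNReal.ofReal ε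

/-- `A` is an empirical risk minimizer up to its confidence parameter: whatever examples of a
target `c ∈ C` it is shown, with probability at least `1 - δ` over its internal randomness it
outputs a concept of `C` that misclassifies none of the examples it has drawn. -/
def IsERM {X : Type u} (C : Set (Set X)) (A : ℝ → ℝ → Learner X C) : Prop :=
  ∀ ε δ : ℝ, 0 < ε → ε < 1 → 0 < δ → δ < 1 → ∀ x : ℕ → X, ∀ c ∈ C,
    ENNReal.ofReal (1 - δ) ≤
      (A ε δ).successProbOn x c (fun N h => ∀ i < N, (x i ∈ h.1 ↔ x i ∈ c)) 0

/-! Procedures that use two sublearners as black boxes. -/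

/-- A procedure that learns pairs from two unknown sublearners. It has no access to the domains
or to the concept classes. The points drawn so far (there are `s` of them) and the
hypotheses received so far from the first and the second sublearner (`h₁` and `h₂` many) are known
to it only as numbered handles.
* `ret o` stops with the product of an earlier first and an earlier second hypothesis, or gives up;
* `draw k` draws a labelled example `((x₁, x₂), b)`, stores the point and goes on with `k b`;
* `eval₁ i j k` evaluates the first-component hypothesis `i` at the first coordinate of
  the stored point `j` and goes on according to the answer;
* `call₁ ε δ a L kNone kSome` runs the first sublearner with parameters `ε, δ`, its examples being
  drawn uniformly from the nonempty list `a :: L` of labelled first coordinates of stored points;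
  it goes on with `kNone` if no hypothesis is returned; otherwise the hypothesis is stored
  and it goes on with `kSome`;
* `eval₂`, `call₂` are the same for the second component. -/
inductive Procedure : ℕ → ℕ → ℕ → Type
  | ret {s h₁ h₂ : ℕ} (o : Option (Fin h₁ × Fin h₂)) : Procedure s h₁ h₂
  | draw {s h₁ h₂ : ℕ} (k : Bool → Procedure (s + 1) h₁ h₂) : Procedure s h₁ h₂
  | eval₁ {s h₁ h₂ : ℕ} (i : Fin h₁) (j : Fin s) (k : Bool → Procedure s h₁ h₂) :
      Procedure s h₁ h₂
  | eval₂ {s h₁ h₂ : ℕ} (i : Fin h₂) (j : Fin s) (k : Bool → Procedure s h₁ h₂) :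
      Procedure s h₁ h₂
  | call₁ {s h₁ h₂ : ℕ} (ε δ : ℝ) (a : Fin s × Bool) (L : List (Fin s × Bool))
      (kNone : Procedure s h₁ h₂) (kSome : Procedure s (h₁ + 1) h₂) : Procedure s h₁ h₂
  | call₂ {s h₁ h₂ : ℕ} (ε δ : ℝ) (a : Fin s × Bool) (L : List (Fin s × Bool))
      (kNone : Procedure s h₁ h₂) (kSome : Procedure s h₁ (h₂ + 1)) : Procedure s h₁ h₂

open Classical in
/-- The learning algorithm over `X₁ × X₂` that a procedure becomes when it is given actual
sublearners. An evaluation takes one step; a call of a sublearner takes one step for each entry of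
the list that is handed over, plus all the steps of the sublearner. The arguments `p`, `g₁`, `g₂`
hold the stored points and hypotheses. -/
def Procedure.toLearner {X₁ : Type u} {X₂ : Type v} {C₁ : Set (Set X₁)} {C₂ : Set (Set X₂)}
    (A₁ : ℝ → ℝ → Learner X₁ C₁) (A₂ : ℝ → ℝ → Learner X₂ C₂) :
    {s h₁ h₂ : ℕ} → Procedure s h₁ h₂ → (Fin s → X₁ × X₂) → (Fin h₁ → C₁) → (Fin h₂ → C₂) →
      Learner (X₁ × X₂) (prodClass C₁ C₂)
  | _, _, _, .ret none, _, _, _ => .ret none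
  | _, _, _, .ret (some (i, j)), _, g₁, g₂ =>
      .ret (some ⟨(g₁ i).1 ×ˢ (g₂ j).1, (g₁ i).1, (g₁ i).2, (g₂ j).1, (g₂ j).2, rfl⟩)
  | _, _, _, .draw k, p, g₁, g₂ =>
      .draw fun x b => (k b).toLearner A₁ A₂ (Fin.snoc (α := fun _ => X₁ × X₂) p x) g₁ g₂
  | _, _, _, .eval₁ i j k, p, g₁, g₂ =>
      .tick ((k (decide ((p j).1 ∈ (g₁ i).1))).toLearner A₁ A₂ p g₁ g₂)
  | _, _, _, .eval₂ i j k, p, g₁, g₂ =>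
      .tick ((k (decide ((p j).2 ∈ (g₂ i).1))).toLearner A₁ A₂ p g₁ g₂)
  | _, _, _, .call₁ ε δ a L kNone kSome, p, g₁, g₂ =>
      Learner.tick^[L.length + 1] <| (A₁ ε δ).simulate L.length
        (fun i : Fin (a :: L).length => ((p ((a :: L).get i).1).1, ((a :: L).get i).2))
        fun o => match o with
          | none => kNone.toLearner A₁ A₂ p g₁ g₂
          | some h => kSome.toLearner A₁ A₂ p (Fin.snoc (α := fun _ => C₁) g₁ h) g₂
  | _, _, _, .call₂ ε δ a L kNone kSome, p, g₁, g₂ =>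
      Learner.tick^[L.length + 1] <| (A₂ ε δ).simulate L.length
        (fun i : Fin (a :: L).length => ((p ((a :: L).get i).1).2, ((a :: L).get i).2))
        fun o => match o with
          | none => kNone.toLearner A₁ A₂ p g₁ g₂
          | some h => kSome.toLearner A₁ A₂ p g₁ (Fin.snoc (α := fun _ => C₂) g₂ h)

/-- The learner over the product domain obtained from a family of procedures, indexed by the
accuracy and the confidence parameter, started with nothing stored. -/
def combine {X₁ : Type u} {X₂ : Type v} {C₁ : Set (Set X₁)} {C₂ : Set (Set X₂)}
    (P : ℝ → ℝ → Procedure 0 0 0) (A₁ : ℝ → ℝ → Learner X₁ C₁) (A₂ : ℝ → ℝ → Learner X₂ C₂) :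
    ℝ → ℝ → Learner (X₁ × X₂) (prodClass C₁ C₂) :=
  fun ε δ => (P ε δ).toLearner A₁ A₂ Fin.elim0 Fin.elim0 Fin.elim0

/-- The sample size `b ((d₁ + d₂) log (2/ε) + log (2/δ)) / ε`, rounded up. -/
def sampleSize (b : ℝ) (d₁ d₂ : ℕ) (ε δ : ℝ) : ℕ :=
  ⌈b * ((d₁ + d₂ : ℝ) * Real.log (2 / ε) + Real.log (2 / δ)) / ε⌉₊

end ModularPAC

end

/-!
Draw `m - 1` examples. It is enough to find a product `c₁ × c₂` that is consistent with all of them: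
the growth function of the product class is at most the product of the two growth functions, so the
usual double sample argument shows that all consistent products have small error
(`exists_measurable_bad_le`).

To find a consistent product, enumerate the traces of `C₁` on the first coordinates of the sample.
A trace `u` that contains all positive points can be completed if and only if some concept of `C₂`
has the given labels on the points of `u`, and that is one question to the second sublearner. A
sublearner with accuracy `1 / m` that is run on fewer than `m` examples answers whether a partial
labelling is realized by its class (`IsPACLearner.le_randProb_simulate`).

The point of the proof is to enumerate the traces of `C₁` with `O(m ^ d₁)` such questions, although
point by point enumeration asks `m` times as many. Keep the set `S` of traces seen so far and the
set `N` of the other sets of points that are not refuted and whose addition to `S` does not raise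
the VC-dimension above `d₁`. If `N` shatters a set `T` of `d₁ + 1` points, then `S` misses two
patterns `τ ≠ τ'` on `T`, and these are asked for. When both are refuted, the sum of their two
indicator functions over the field with two elements vanishes on the new `N`. It does not vanish on
the old one, and since the terms of top degree cancel it is a polynomial of degree at most `d₁`. The
polynomials of degree at most `d₁` that vanish on `N` thus gain a dimension, which can happen at
most as often as there are sets of at most `d₁` points. If `N` shatters no such set, then Sauer's
lemma bounds its size, and its elements are asked for one by one. So every round lowers a potential
that is bounded by `3 * m ^ max d₁ 1` (`exists_query`, `potential_insert_lt`).

A question costs the first sublearner's running time and the length of a list, and a newly seen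
trace costs `O(m)` evaluations besides. These costs are covered by the running time of the first
sublearner, which is at least `m / 4` if `C₁` has two concepts that agree at some point and differ
at another one (`IsPACLearner.le_time`). Otherwise `d₁ ≤ 1` and there are at most two traces, so
that the lists have length at most two and the expensive rounds are at most two.
-/

noncomputable section

namespace ModularPAC

open Finset MeasureTheory
open scoped Classical

/-! ### Traces of a class and Sauer's bound -/

/-- The trace of the concept `c` on the points `q i`, as a set of indices. -/
def trace {X ι : Type*} [Fintype ι] (q : ι → X) (c : Set X) : Finset ι := {i | q i ∈ c}

/-- All traces of concepts of `C` on the points `q i`. -/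
def traces {X ι : Type*} [Fintype ι] (q : ι → X) (C : Set (Set X)) : Finset (Finset ι) :=
  {t | ∃ c ∈ C, trace q c = t}

@[simp] lemma mem_trace {X ι : Type*} [Fintype ι] {q : ι → X} {c : Set X} {i : ι} :
    i ∈ trace q c ↔ q i ∈ c := by simp [trace]

@[simp] lemma mem_traces {X ι : Type*} [Fintype ι] {q : ι → X} {C : Set (Set X)} {t : Finset ι} :
    t ∈ traces q C ↔ ∃ c ∈ C, trace q c = t := by simp [traces]

/-- The points `q i` need not be distinct, but they are on any set of indices that the traces
shatter. -/
lemma card_le_of_shatters_traces {X ι : Type*} [Fintype ι] [DecidableEq ι] {q : ι → X}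
    {C : Set (Set X)} {d : ℕ}
    (hC : vcDim C ≤ d) {T : Finset ι} (hT : (traces q C).Shatters T) : T.card ≤ d := by
  have hinj : Set.InjOn q T := by
    intro i hi j hj hij
    by_contra hne
    obtain ⟨u, hu, hTu⟩ := hT.exists_inter_eq_singleton hi
    obtain ⟨c, -, rfl⟩ := mem_traces.1 hu
    have h1 : i ∈ T ∩ trace q c := by simp [hTu]
    have h2 : j ∉ T ∩ trace q c := by rw [hTu]; simpa using Ne.symm hne
    simp only [mem_inter, mem_trace, not_and] at h1 h2
    exact h2 hj (hij ▸ h1.2)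
  have hs : Shatters C (T.image q) := by
    intro t ht
    obtain ⟨u, hu, hTu⟩ := hT (filter_subset (fun i => q i ∈ t) T)
    obtain ⟨c, hc, rfl⟩ := mem_traces.1 hu
    refine ⟨c, hc, ?_⟩
    ext x
    constructor
    · rintro ⟨hx, hxc⟩
      obtain ⟨i, hi, rfl⟩ := mem_image.1 (mem_coe.1 hx)
      have : i ∈ T ∩ trace q c := by simpa using ⟨hi, hxc⟩
      rw [hTu] at this
      exact (mem_filter.1 this).2
    · intro hx
      obtain ⟨i, hi, rfl⟩ := mem_image.1 (mem_coe.1 (ht hx))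
      have : i ∈ T ∩ trace q c := by rw [hTu]; simpa using ⟨hi, hx⟩
      exact ⟨ht hx, by simpa using (mem_inter.1 this).2⟩
  have := (le_iSup (fun s : {s : Finset X // Shatters C s} => (s.1.card : ℕ∞)) ⟨_, hs⟩).trans hC
  rw [card_image_of_injOn hinj] at this
  exact_mod_cast this

/-- The number of subsets of size at most `d` of a set of size `n`. -/
def sauer (d n : ℕ) : ℕ := ∑ k ∈ range (d + 1), n.choose k

lemma sauer_pos (d n : ℕ) : 0 < sauer d n :=
  Finset.sum_pos' (fun _ _ => Nat.zero_le _) ⟨0, by simp, by simp⟩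

lemma choose_le_sauer {d n : ℕ} : n.choose d ≤ sauer d n :=
  Finset.single_le_sum (f := fun k => n.choose k) (fun _ _ => Nat.zero_le _) (by simp)

lemma sauer_le_pow (d n : ℕ) : sauer d n ≤ (n + 1) ^ d := by
  induction d with
  | zero => simp [sauer]
  | succ d ih =>
    have h1 : n.choose (d + 1) ≤ n.choose d * n := by
      have := Nat.choose_succ_right_eq n d
      calc n.choose (d + 1) ≤ n.choose (d + 1) * (d + 1) := Nat.le_mul_of_pos_right _ (by omega)
        _ = n.choose d * (n - d) := this
        _ ≤ _ := Nat.mul_le_mul_left _ (Nat.sub_le _ _)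
    have h2 : sauer (d + 1) n = sauer d n + n.choose (d + 1) := by
      simp [sauer, sum_range_succ]
    rw [h2, pow_succ]
    have h3 := Nat.mul_le_mul_right n (choose_le_sauer (d := d) (n := n))
    nlinarith [Nat.mul_le_mul_right n ih]

/-- The form of Sauer's bound that makes the sample complexity come out with a logarithm of
`1 / ε` only: `x` is chosen proportional to `ε`. -/
lemma sauer_le_exp (d n : ℕ) {x : ℝ} (hx : 0 < x) (hx1 : x ≤ 1) :
    (sauer d n : ℝ) ≤ (1 / x) ^ d * Real.exp (x * n) := by
  have h : x ^ d * (sauer d n : ℝ) ≤ (x + 1) ^ n := by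
    rw [add_pow]
    simp only [one_pow, mul_one]
    have : (sauer d n : ℝ) = ∑ k ∈ range (min d n + 1), (n.choose k : ℝ) := by
      rw [sauer]
      push_cast
      symm
      refine sum_subset (by intro k; simp only [mem_range]; omega) fun k hk hk' => ?_
      rw [Nat.choose_eq_zero_of_lt, Nat.cast_zero]
      simp only [mem_range] at hk hk'
      omega
    rw [this, mul_sum]
    refine (sum_le_sum fun k hk => ?_).trans
      (sum_le_sum_of_subset_of_nonneg (s := range (min d n + 1)) (t := range (n + 1)) ?_ ?_)
    · refine mul_le_mul_of_nonneg_right (pow_le_pow_of_le_one hx.le hx1 ?_) (by positivity)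
      simp only [mem_range] at hk
      omega
    · intro k; simp only [mem_range]; omega
    · intros; positivity
  have h2 : (x + 1) ^ n ≤ Real.exp (x * n) := by
    rw [mul_comm, Real.exp_nat_mul]
    exact pow_le_pow_left₀ (by positivity) (Real.add_one_le_exp x) n
  rw [one_div, inv_pow, ← div_eq_inv_mul, le_div_iff₀ (by positivity), mul_comm]
  exact h.trans h2

lemma card_le_sauer {α : Type*} [Fintype α] [DecidableEq α] {𝒜 : Finset (Finset α)} {d : ℕ}
    (h : ∀ T, 𝒜.Shatters T → T.card ≤ d) : 𝒜.card ≤ sauer d (Fintype.card α) := by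
  refine (card_le_card_shatterer 𝒜).trans (card_shatterer_le_sum_vcDim.trans ?_)
  refine sum_le_sum_of_subset fun k hk => ?_
  have : 𝒜.vcDim ≤ d := Finset.sup_le fun T hT => h T (mem_shatterer.1 hT)
  simp only [mem_Iic, mem_range] at hk ⊢
  omega

lemma card_traces_le {X ι : Type*} [Fintype ι] (q : ι → X) {C : Set (Set X)} {d : ℕ}
    (hC : vcDim C ≤ d) : (traces q C).card ≤ sauer d (Fintype.card ι) :=
  card_le_sauer fun _ => card_le_of_shatters_traces hC

/-! ### Polynomials of low degree over the field with two elements -/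

section LowDegree

variable {α : Type*} [Fintype α] [DecidableEq α]

/-- The monomial with variables in `A`, as a function on the subsets of `α`. -/
def mono (A u : Finset α) : ZMod 2 := if A ⊆ u then 1 else 0

/-- The indicator function of the event that a set agrees with `τ` on `T`. -/
def ind (T τ u : Finset α) : ZMod 2 := if T ∩ u = T ∩ τ then 1 else 0

/-- The functions on the subsets of `α` that are given by polynomials of degree at most `d`. -/
def lowDeg (α : Type*) [Fintype α] [DecidableEq α] (d : ℕ) :
    Submodule (ZMod 2) (Finset α → ZMod 2) :=
  Submodule.span (ZMod 2)
    (((range (d + 1)).biUnion fun k => powersetCard k (univ : Finset α)).image mono : Finset _)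

lemma finrank_lowDeg_le (d : ℕ) :
    Module.finrank (ZMod 2) (lowDeg α d) ≤ sauer d (Fintype.card α) := by
  refine (finrank_span_finset_le_card _).trans (card_image_le.trans (card_biUnion_le.trans ?_))
  simp [sauer]

lemma mono_mem_lowDeg {d : ℕ} {A : Finset α} (hA : A.card ≤ d) : mono A ∈ lowDeg α d := by
  refine Submodule.subset_span ?_
  simp only [coe_image, Set.mem_image, mem_coe, mem_biUnion, mem_range, mem_powersetCard]
  exact ⟨A, ⟨A.card, by omega, subset_univ _, rfl⟩, rfl⟩

lemma ind_eq_sum (T τ : Finset α) :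
    ind T τ = ∑ t ∈ T.powerset, (∏ i ∈ T \ t, if i ∈ τ then (0 : ZMod 2) else 1) • mono t := by
  funext u
  have h1 : ind T τ u = ∏ i ∈ T, ((if i ∈ u then (1 : ZMod 2) else 0) +
      if i ∈ τ then (0 : ZMod 2) else 1) := by
    rw [ind]
    split_ifs with h
    · symm
      refine prod_eq_one fun i hi => ?_
      have : i ∈ u ↔ i ∈ τ := by
        have := congrArg (i ∈ ·) h
        simpa [hi] using this
      by_cases hu : i ∈ u <;> simp [hu, ← this]
    · symm
      by_contra h0
      refine h (Finset.ext fun i => ?_)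
      simp only [mem_inter, and_congr_right_iff]
      intro hi
      have h2 := prod_ne_zero_iff.1 h0 i hi
      by_cases hu : i ∈ u <;> by_cases ht : i ∈ τ <;> simp [hu, ht] at h2 ⊢
      exact h2 (by decide)
  rw [h1, prod_add, Finset.sum_apply]
  refine sum_congr rfl fun t _ => ?_
  rw [Pi.smul_apply, smul_eq_mul, mul_comm]
  congr 1
  rw [mono, prod_ite_zero]
  simp [subset_iff]

/-- In characteristic two the terms of top degree of two indicator functions cancel. -/
lemma ind_add_ind_mem {d : ℕ} {T : Finset α} (hT : T.card = d + 1) (τ τ' : Finset α) :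
    ind T τ + ind T τ' ∈ lowDeg α d := by
  rw [ind_eq_sum, ind_eq_sum, ← sum_add_distrib]
  refine Submodule.sum_mem _ fun t ht => ?_
  rw [← add_smul]
  by_cases h : t = T
  · subst h
    simp [CharTwo.add_self_eq_zero]
  · refine Submodule.smul_mem _ _ (mono_mem_lowDeg ?_)
    have := card_lt_card ((mem_powerset.1 ht).ssubset_of_ne h)
    omega

/-- The polynomials of degree at most `d` that vanish on `N`. -/
def vanishing (d : ℕ) (N : Finset (Finset α)) : Submodule (ZMod 2) (Finset α → ZMod 2) where
  carrier := {f | f ∈ lowDeg α d ∧ ∀ u ∈ N, f u = 0}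
  add_mem' := fun ha hb => ⟨add_mem ha.1 hb.1, fun u hu => by simp [ha.2 u hu, hb.2 u hu]⟩
  zero_mem' := ⟨zero_mem _, fun _ _ => rfl⟩
  smul_mem' := by
    rintro c f ⟨hf, h0⟩
    exact ⟨Submodule.smul_mem _ c hf, fun u hu => by simp [h0 u hu]⟩

lemma vanishing_anti (d : ℕ) {N N' : Finset (Finset α)} (h : N' ⊆ N) :
    vanishing d N ≤ vanishing d N' := fun _ hf => ⟨hf.1, fun u hu => hf.2 u (h hu)⟩

lemma finrank_vanishing_le (d : ℕ) (N : Finset (Finset α)) :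
    Module.finrank (ZMod 2) (vanishing d N) ≤ sauer d (Fintype.card α) :=
  (Submodule.finrank_mono (fun _ hf => hf.1 : vanishing d N ≤ lowDeg α d)).trans
    (finrank_lowDeg_le d)

end LowDegree

/-! ### Choosing the next consistency query -/

section Choice

variable {α : Type*} [DecidableEq α]

/-- The candidates of `N` that agree neither with `τ` nor with `τ'` on `T`. -/
def refute (T τ τ' : Finset α) (N : Finset (Finset α)) : Finset (Finset α) :=
  {u ∈ N | T ∩ u ≠ T ∩ τ ∧ T ∩ u ≠ T ∩ τ'}

lemma refute_subset {T τ τ' : Finset α} {N : Finset (Finset α)} : refute T τ τ' N ⊆ N :=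
  filter_subset _ _

variable [Fintype α]

/-- The candidates of `N` that may still be unseen traces of a class of VC-dimension at most `d`,
when the traces in `S` have been seen. -/
def prune (d : ℕ) (S N : Finset (Finset α)) : Finset (Finset α) :=
  {u ∈ N | u ∉ S ∧ ∀ T, (insert u S).Shatters T → T.card ≤ d}

/-- The number of rounds that are certainly enough from a state with seen traces `S` and
candidates `N`. -/
def potential (d B : ℕ) (S N : Finset (Finset α)) : ℕ :=
  (B - S.card) + (B - Module.finrank (ZMod 2) (vanishing d (prune d S N))) +
    min (prune d S N).card B

/-- What is required of the next two queries, which ask for a concept that agrees on `T` with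
`τ`, respectively `τ'`: no seen trace answers them, `T` is small, and two negative answers are
progress. -/
structure Query (d B : ℕ) (S N : Finset (Finset α)) (x : Finset α × Finset α × Finset α) :
    Prop where
  nonempty : x.1.Nonempty
  fresh : ∀ v ∈ S, x.1 ∩ v ≠ x.1 ∩ x.2.1 ∧ x.1 ∩ v ≠ x.1 ∩ x.2.2
  card_le : x.1.card ≤ max (d + 1) S.card
  progress : potential d B S (refute x.1 x.2.1 x.2.2 N) < potential d B S N

lemma prune_mono_right {d : ℕ} {S N N' : Finset (Finset α)} (h : N' ⊆ N) :
    prune d S N' ⊆ prune d S N := filter_subset_filter _ h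

lemma prune_mono_left {d : ℕ} {S S' N : Finset (Finset α)} (h : S ⊆ S') :
    prune d S' N ⊆ prune d S N := by
  intro u hu
  simp only [prune, mem_filter] at hu ⊢
  exact ⟨hu.1, fun hS => hu.2.1 (h hS), fun T hT =>
    hu.2.2 T (hT.mono_left (insert_subset_insert _ h))⟩

lemma prune_refute {d : ℕ} {T τ τ' : Finset α} {S N : Finset (Finset α)} :
    prune d S (refute T τ τ' N) = refute T τ τ' (prune d S N) := by
  ext u; simp only [prune, refute, mem_filter]; tauto

/-- As soon as the candidates shatter a set `T` of size `d + 1`, the seen traces miss two patterns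
on `T`. If both are refuted, then the sum of their indicators is a new polynomial of degree at
most `d` that vanishes on the candidates. If the candidates shatter no such set, then there are
few of them, and they are refuted one at a time. -/
lemma exists_query [Nonempty α] {d B : ℕ} (hB : sauer d (Fintype.card α) ≤ B)
    {S N : Finset (Finset α)} (hN : (prune d S N).Nonempty) : ∃ x, Query d B S N x := by
  by_cases hsh : ∃ T, (prune d S N).Shatters T ∧ d < T.card
  · obtain ⟨T₀, hT₀, hd⟩ := hsh
    obtain ⟨T, hTT, hT⟩ := exists_subset_card_eq (s := T₀) (n := d + 1) hd
    replace hT₀ := hT₀.mono_right hTT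
    have key : ∀ u ∈ prune d S N, ∃ τ, T ∩ τ ≠ T ∩ u ∧ ∀ v ∈ S, T ∩ v ≠ T ∩ τ := by
      intro u hu
      by_contra! hcon
      have := (mem_filter.1 hu).2.2 T (by
        intro t ht
        by_cases h : t = T ∩ u
        · exact ⟨u, mem_insert_self _ _, h.symm⟩
        · obtain ⟨v, hv, hvt⟩ := hcon t (by rwa [inter_eq_right.2 ht])
          exact ⟨v, mem_insert_of_mem hv, by rw [hvt, inter_eq_right.2 ht]⟩)
      omega
    obtain ⟨u₁, hu₁⟩ := hN
    obtain ⟨τ, -, hτ⟩ := key u₁ hu₁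
    obtain ⟨u₂, hu₂, hu₂τ⟩ := hT₀ (inter_subset_left : T ∩ τ ⊆ T)
    obtain ⟨τ', hne, hτ'⟩ := key u₂ hu₂
    rw [hu₂τ] at hne
    refine ⟨(T, τ, τ'), ?_, fun v hv => ⟨hτ v hv, hτ' v hv⟩, ?_, ?_⟩
    · exact card_pos.1 (by simp only; omega)
    · simp only; omega
    · have hlt : vanishing d (prune d S N) < vanishing d (prune d S (refute T τ τ' N)) := by
        refine lt_of_le_of_ne (vanishing_anti d (prune_mono_right refute_subset)) fun heq => ?_
        have hg : ind T τ + ind T τ' ∈ vanishing d (prune d S (refute T τ τ' N)) := by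
          refine ⟨ind_add_ind_mem hT τ τ', fun u hu => ?_⟩
          rw [prune_refute] at hu
          have := (mem_filter.1 hu).2
          simp [ind, this.1, this.2]
        rw [← heq] at hg
        have := hg.2 u₂ hu₂
        simp [ind, hu₂τ, hne.symm] at this
      have h1 := Submodule.finrank_lt_finrank_of_lt hlt
      have h2 := (finrank_vanishing_le d (prune d S (refute T τ τ' N))).trans hB
      have h3 := card_le_card (prune_mono_right (d := d) (S := S)
        (refute_subset (T := T) (τ := τ) (τ' := τ') (N := N)))
      simp only [potential]
      omega
  · push Not at hsh
    obtain ⟨u, hu⟩ := hN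
    have huS := (mem_filter.1 hu).2.1
    have hdiff : ∀ v ∈ S, ∃ i, ¬ (i ∈ v ↔ i ∈ u) := by
      intro v hv
      by_contra! h
      exact huS (by rwa [← Finset.ext h])
    choose! f hf using hdiff
    obtain ⟨T, hT, hTc, hTS⟩ : ∃ T : Finset α, T.Nonempty ∧ T.card ≤ max (d + 1) S.card ∧
        ∀ v ∈ S, T ∩ v ≠ T ∩ u := by
      rcases S.eq_empty_or_nonempty with rfl | hS
      · exact ⟨{Classical.arbitrary α}, by simp, by simp, by simp⟩
      · refine ⟨S.image f, hS.image _, card_image_le.trans (le_max_right _ _), fun v hv h => ?_⟩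
        have := congrArg (f v ∈ ·) h
        simp only [mem_inter, mem_image_of_mem f hv, true_and, eq_iff_iff] at this
        exact hf v hv this
    refine ⟨(T, u, u), hT, fun v hv => ⟨hTS v hv, hTS v hv⟩, hTc, ?_⟩
    have hlt : prune d S (refute T u u N) ⊂ prune d S N := by
      refine (prune_mono_right refute_subset).ssubset_of_ne fun heq => ?_
      rw [← heq, prune_refute] at hu
      exact (mem_filter.1 hu).2.1 rfl
    have h1 := card_lt_card hlt
    have h2 := (card_le_sauer (d := d) fun T hT => by
      simpa using hsh T hT : (prune d S N).card ≤ _).trans hB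
    have h3 := Submodule.finrank_mono (vanishing_anti d hlt.subset)
    simp only [potential]
    omega

/-- A positive answer to a query is progress, too. -/
lemma potential_insert_lt {d B : ℕ} {S N : Finset (Finset α)} {u : Finset α} (hu : u ∉ S)
    (hS : (insert u S).card ≤ B) : potential d B (insert u S) N < potential d B S N := by
  have h := prune_mono_left (d := d) (N := N) (subset_insert u S)
  have h1 := card_le_card h
  have h3 := Submodule.finrank_mono (vanishing_anti d h)
  rw [card_insert_of_notMem hu] at hS
  simp only [potential, card_insert_of_notMem hu]
  omega

lemma potential_pos {d B : ℕ} {S N : Finset (Finset α)} (hB : 0 < B) (hN : (prune d S N).Nonempty) :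
    0 < potential d B S N := by
  have := card_pos.2 hN
  simp only [potential]
  omega

lemma potential_le (d B : ℕ) (S N : Finset (Finset α)) : potential d B S N ≤ 3 * B := by
  simp only [potential]
  omega

/-- The next queries; `(∅, ∅, ∅)` if there are none, which happens only when no candidates are
left. -/
def nextQuery (d B : ℕ) (S N : Finset (Finset α)) : Finset α × Finset α × Finset α :=
  if h : ∃ x, Query d B S N x then h.choose else (∅, ∅, ∅)

lemma nextQuery_spec {d B : ℕ} {S N : Finset (Finset α)} (h : ∃ x, Query d B S N x) :
    Query d B S N (nextQuery d B S N) := by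
  rw [nextQuery, dif_pos h]
  exact h.choose_spec

lemma card_nextQuery_le (d B : ℕ) (S N : Finset (Finset α)) :
    (nextQuery d B S N).1.card ≤ max (d + 1) S.card := by
  by_cases h : ∃ x, Query d B S N x
  · exact (nextQuery_spec h).card_le
  · simp [nextQuery, h]

lemma nextQuery_fresh (d B : ℕ) (S N : Finset (Finset α)) (hne : (nextQuery d B S N).1.Nonempty) :
    ∀ v ∈ S, (nextQuery d B S N).1 ∩ v ≠ (nextQuery d B S N).1 ∩ (nextQuery d B S N).2.1 ∧
      (nextQuery d B S N).1 ∩ v ≠ (nextQuery d B S N).1 ∩ (nextQuery d B S N).2.2 := by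
  by_cases h : ∃ x, Query d B S N x
  · exact (nextQuery_spec h).fresh
  · simp [nextQuery, h] at hne

end Choice

/-! ### Consistent concepts have small error -/

section EpsNet

variable {X : Type*} [MeasurableSpace X]

/-- A set of measure more than `ε` is rarely hit fewer than `k` times by `n` independent points. -/
lemma half_le_measure_hits (D : Measure X) [IsProbabilityMeasure D] {e : Set X}
    (he : MeasurableSet e) {ε : ℝ} (hε : ε ≤ D.real e) {n k : ℕ}
    (hk : (2 : ℝ) ^ k * (1 - ε / 2) ^ n ≤ 1 / 2) :
    (1 / 2 : ℝ≥0∞) ≤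
      Measure.pi (fun _ : Fin n => D) {x | k ≤ #{i | x i ∈ e}} := by
  set μ := Measure.pi (fun _ : Fin n => D)
  let f : X → ℝ := fun x => if x ∈ e then 1 / 2 else 1
  have hf : Measurable f := Measurable.ite he measurable_const measurable_const
  have hf0 : ∀ x, 0 ≤ f x := fun x => by simp only [f]; split_ifs <;> norm_num
  have hf1 : ∀ x, f x ≤ 1 := fun x => by simp only [f]; split_ifs <;> norm_num
  have hcard : Measurable fun x : Fin n → X => #{i | x i ∈ e} := by
    simp only [card_filter]
    refine Finset.measurable_sum _ fun i _ => ?_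
    exact Measurable.ite (measurable_pi_apply i he) measurable_const measurable_const
  have hmeas : MeasurableSet {x : Fin n → X | k ≤ #{i | x i ∈ e}} :=
    hcard measurableSet_Ici
  have hint : ∫ x, f x ∂D = 1 - D.real e / 2 := by
    have : f = fun x => 1 - e.indicator (fun _ => (1 / 2 : ℝ)) x := by
      funext x; by_cases hx : x ∈ e <;> simp [f, hx]; norm_num
    rw [this, integral_sub (integrable_const _) ((integrable_const _).indicator he),
      integral_indicator he]
    simp
    ring
  have hprod : ∀ x : Fin n → X, ∏ i, f (x i) = (1 / 2) ^ #{i | x i ∈ e} := by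
    intro x
    simp only [f]
    rw [prod_ite]
    simp
  have hbound : μ.real {x | k ≤ #{i | x i ∈ e}}ᶜ ≤ 1 / 2 := by
    rw [← integral_indicator_one hmeas.compl]
    calc ∫ x, ({x : Fin n → X | k ≤ #{i | x i ∈ e}}ᶜ).indicator 1 x ∂μ
        ≤ ∫ x, 2 ^ k * ∏ i, f (x i) ∂μ := by
          refine integral_mono ((integrable_const (1 : ℝ)).indicator hmeas.compl) ?_ fun x => ?_
          · refine Integrable.of_bound (C := 2 ^ k) ?_ (Filter.Eventually.of_forall fun x => ?_)
            · refine Measurable.aestronglyMeasurable ?_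
              exact (Finset.measurable_prod _ fun i _ =>
                hf.comp (measurable_pi_apply i)).const_mul _
            · rw [Real.norm_of_nonneg (by have := prod_nonneg fun i (_ : i ∈ univ) => hf0 (x i)
                                          positivity)]
              exact mul_le_of_le_one_right (by positivity)
                (prod_le_one (fun i _ => hf0 _) fun i _ => hf1 _)
          · by_cases hx : k ≤ #{i | x i ∈ e}
            · rw [Set.indicator_of_notMem (by simpa using hx)]
              have := prod_nonneg fun i (_ : i ∈ univ) => hf0 (x i)
              positivity
            · rw [Set.indicator_of_mem (by simpa using hx), Pi.one_apply]
              simp only [hprod]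
              rw [one_div, inv_pow, ← div_eq_mul_inv, one_le_div (by positivity)]
              exact pow_le_pow_right₀ (by norm_num) (by omega)
      _ = 2 ^ k * (1 - D.real e / 2) ^ n := by
          rw [integral_const_mul, integral_fintype_prod_eq_pow, hint, Fintype.card_fin]
      _ ≤ 2 ^ k * (1 - ε / 2) ^ n := by
          have h1 : D.real e ≤ 1 := measureReal_le_one
          refine mul_le_mul_of_nonneg_left (pow_le_pow_left₀ ?_ ?_ n) (by positivity) <;> linarith
      _ ≤ 1 / 2 := hk
  rw [probReal_compl_eq_one_sub hmeas] at hbound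
  have h2 : (1 / 2 : ℝ) ≤ μ.real {x | k ≤ #{i | x i ∈ e}} := by linarith
  have h3 := ENNReal.ofReal_le_ofReal h2
  rw [ofReal_measureReal] at h3
  refine le_trans (le_of_eq ?_) h3
  rw [ENNReal.ofReal_div_of_pos (by norm_num)]
  simp

/-- Among all choices `σ` of one element from each of `n` pairs, at most a fraction `2⁻ᵏ` avoids a
given set `t` of elements such that `t` contains `k` of the elements that are not chosen. -/
lemma card_swaps_mul_le {n k : ℕ} (t : Finset (Fin n × Bool)) :
    #{σ : Fin n → Bool | (∀ i, (i, σ i) ∉ t) ∧ k ≤ #{i | (i, !σ i) ∈ t}} * 2 ^ k ≤ 2 ^ n := by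
  let w : Fin n → Bool → ℕ := fun i b =>
    if (i, b) ∈ t then 0 else if (i, !b) ∈ t then 2 else 1
  calc #{σ : Fin n → Bool | (∀ i, (i, σ i) ∉ t) ∧ k ≤ #{i | (i, !σ i) ∈ t}} * 2 ^ k
      = ∑ σ : Fin n → Bool with (∀ i, (i, σ i) ∉ t) ∧ k ≤ #{i | (i, !σ i) ∈ t}, 2 ^ k := by
        simp
    _ ≤ ∑ σ : Fin n → Bool with (∀ i, (i, σ i) ∉ t) ∧ k ≤ #{i | (i, !σ i) ∈ t},
          ∏ i, w i (σ i) := by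
        refine sum_le_sum fun σ hσ => ?_
        simp only [mem_filter, mem_univ, true_and] at hσ
        have : ∏ i, w i (σ i) = 2 ^ #{i | (i, !σ i) ∈ t} := by
          simp only [w, hσ.1, if_false]
          rw [prod_ite]
          simp
        rw [this]
        exact Nat.pow_le_pow_right (by norm_num) hσ.2
    _ ≤ ∑ σ : Fin n → Bool, ∏ i, w i (σ i) :=
        sum_le_sum_of_subset (filter_subset _ _)
    _ = ∏ i, ∑ b, w i b := by
        rw [prod_univ_sum, Fintype.piFinset_univ]
    _ ≤ ∏ _i : Fin n, 2 := by
        refine prod_le_prod' fun i _ => ?_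
        simp only [Fintype.univ_bool, mem_singleton, Bool.true_eq_false, not_false_eq_true,
          sum_insert, sum_singleton, w, Bool.not_true, Bool.not_false]
        split_ifs <;> simp
    _ = 2 ^ n := by simp

/-- Exchange the two entries of the `i`-th pair if `σ i` is true. -/
def swapAt {n : ℕ} (σ : Fin n → Bool) (z : Fin n → X × X) : Fin n → X × X :=
  fun i => bif σ i then (z i).swap else z i

lemma measurePreserving_swapAt (D : Measure X) [IsProbabilityMeasure D] {n : ℕ}
    (σ : Fin n → Bool) :
    MeasurePreserving (swapAt (X := X) σ) (Measure.pi fun _ : Fin n => D.prod D)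
      (Measure.pi fun _ : Fin n => D.prod D) := by
  refine measurePreserving_pi (f := fun i (y : X × X) => bif σ i then y.swap else y)
    (fun _ : Fin n => D.prod D) (fun _ : Fin n => D.prod D) fun i => ?_
  cases σ i
  · exact MeasurePreserving.id _
  · exact Measure.measurePreserving_swap

/-- The double sample argument for a countable family `ℰ` of sets of measure at least `ε`: the
probability that `n` points miss one of them is small if the family has few traces on `2 * n`
points. -/
lemma measure_exists_missed_le (D : Measure X) [IsProbabilityMeasure D] {ℰ : Set (Set X)}
    (hc : ℰ.Countable) (hm : ∀ e ∈ ℰ, MeasurableSet e) {ε : ℝ} (hε : ∀ e ∈ ℰ, ε ≤ D.real e)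
    {n k W : ℕ} (hk : (2 : ℝ) ^ k * (1 - ε / 2) ^ n ≤ 1 / 2)
    (hW : ∀ q : Fin n × Bool → X, (traces q ℰ).card ≤ W) :
    Measure.pi (fun _ : Fin n => D) {x | ∃ e ∈ ℰ, ∀ i, x i ∉ e} ≤ 2 * W / 2 ^ k := by
  set μ := Measure.pi (fun _ : Fin n => D)
  set π := Measure.pi (fun _ : Fin n => D.prod D)
  set B : Set (Fin n → X) := {x | ∃ e ∈ ℰ, ∀ i, x i ∉ e}
  let B₂ : Set (Fin n → X × X) := {z | ∃ e ∈ ℰ, (∀ i, (z i).1 ∉ e) ∧ k ≤ #{i | (z i).2 ∈ e}}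
  let B₂' : Set ((Fin n → X) × (Fin n → X)) :=
    {z | ∃ e ∈ ℰ, (∀ i, z.1 i ∉ e) ∧ k ≤ #{i | z.2 i ∈ e}}
  have hmiss : ∀ e ∈ ℰ, MeasurableSet {x : Fin n → X | ∀ i, x i ∉ e} := fun e he => by
    rw [Set.ofPred_forall]
    exact MeasurableSet.iInter fun i => (measurable_pi_apply i (hm e he)).compl
  have hhit : ∀ e ∈ ℰ, MeasurableSet {x : Fin n → X | k ≤ #{i | x i ∈ e}} := fun e he => by
    have hcard : Measurable fun x : Fin n → X => #{i | x i ∈ e} := by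
      simp only [card_filter]
      refine Finset.measurable_sum _ fun i _ => ?_
      exact Measurable.ite (measurable_pi_apply i (hm e he)) measurable_const measurable_const
    exact hcard measurableSet_Ici
  have hB : MeasurableSet B := by
    have : B = ⋃ e ∈ ℰ, {x : Fin n → X | ∀ i, x i ∉ e} := by ext; simp [B]
    rw [this]
    exact MeasurableSet.biUnion hc hmiss
  have hB₂' : MeasurableSet B₂' := by
    have : B₂' = ⋃ e ∈ ℰ, {x : Fin n → X | ∀ i, x i ∉ e} ×ˢ
        {x : Fin n → X | k ≤ #{i | x i ∈ e}} := by
      ext; simp only [B₂', Set.mem_ofPred_eq, Set.mem_iUnion, Set.mem_prod, exists_prop]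
    rw [this]
    exact MeasurableSet.biUnion hc fun e he => (hmiss e he).prod (hhit e he)
  have hpre : B₂ = MeasurableEquiv.arrowProdEquivProdArrow X X (Fin n) ⁻¹' B₂' := rfl
  have hB₂ : MeasurableSet B₂ := hpre ▸ (MeasurableEquiv.measurable _ hB₂')
  have h1 : μ B ≤ 2 * π B₂ := by
    have h : π B₂ = (μ.prod μ) B₂' := by
      rw [hpre]
      exact (measurePreserving_arrowProdEquivProdArrow X X (Fin n) (fun _ => D)
        (fun _ => D)).measure_preimage hB₂'.nullMeasurableSet
    rw [h, Measure.prod_apply hB₂']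
    have : (1 / 2 : ℝ≥0∞) * μ B ≤ ∫⁻ x, μ (Prod.mk x ⁻¹' B₂') ∂μ := by
      rw [← lintegral_indicator_const hB]
      refine lintegral_mono fun x => ?_
      by_cases hx : x ∈ B
      · rw [Set.indicator_of_mem hx]
        obtain ⟨e, he, hxe⟩ := hx
        refine (half_le_measure_hits D (hm e he) (hε e he) hk).trans (measure_mono fun y hy => ?_)
        exact ⟨e, he, hxe, hy⟩
      · simp [hx]
    calc μ B = 2 * ((1 / 2 : ℝ≥0∞) * μ B) := by
          rw [← mul_assoc, one_div, ENNReal.mul_inv_cancel (by norm_num) (by norm_num), one_mul]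
      _ ≤ _ := by gcongr
  have hcount : ∀ z : Fin n → X × X,
      #{σ : Fin n → Bool | swapAt σ z ∈ B₂} * 2 ^ k ≤ W * 2 ^ n := by
    intro z
    let q : Fin n × Bool → X := fun a => bif a.2 then (z a.1).2 else (z a.1).1
    have hsub : (univ.filter fun σ : Fin n → Bool => swapAt σ z ∈ B₂) ⊆
        (traces q ℰ).biUnion fun t =>
          {σ : Fin n → Bool | (∀ i, (i, σ i) ∉ t) ∧ k ≤ #{i | (i, !σ i) ∈ t}} := by
      intro σ hσ
      obtain ⟨e, he, h1, h2⟩ := (mem_filter.1 hσ).2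
      refine mem_biUnion.2 ⟨trace q e, mem_traces.2 ⟨e, he, rfl⟩, ?_⟩
      simp only [mem_filter, mem_univ, true_and, mem_trace]
      have e1 : ∀ i, q (i, σ i) = (swapAt σ z i).1 := fun i => by
        simp only [q, swapAt]; cases σ i <;> rfl
      have e2 : ∀ i, q (i, !σ i) = (swapAt σ z i).2 := fun i => by
        simp only [q, swapAt]; cases σ i <;> rfl
      simp only [e1, e2]
      exact ⟨h1, h2⟩
    calc _ ≤ (∑ t ∈ traces q ℰ,
          #{σ : Fin n → Bool | (∀ i, (i, σ i) ∉ t) ∧ k ≤ #{i | (i, !σ i) ∈ t}}) * 2 ^ k :=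
          Nat.mul_le_mul_right _ ((card_le_card hsub).trans card_biUnion_le)
      _ ≤ ∑ _t ∈ traces q ℰ, 2 ^ n := by
          rw [sum_mul]
          exact sum_le_sum fun t _ => card_swaps_mul_le t
      _ ≤ W * 2 ^ n := by
          rw [sum_const, smul_eq_mul]
          exact Nat.mul_le_mul_right _ (hW q)
  have h2 : 2 ^ n * π B₂ * 2 ^ k ≤ W * 2 ^ n := by
    calc 2 ^ n * π B₂ * 2 ^ k
        = (∑ σ : Fin n → Bool, ∫⁻ z, B₂.indicator 1 (swapAt σ z) ∂π) * 2 ^ k := by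
          congr 1
          have : ∀ σ : Fin n → Bool, ∫⁻ z, B₂.indicator 1 (swapAt σ z) ∂π = π B₂ := fun σ => by
            rw [(measurePreserving_swapAt D σ).lintegral_comp
              (measurable_one.indicator hB₂), lintegral_indicator_one hB₂]
          simp [this]
      _ = ∫⁻ z, (∑ σ : Fin n → Bool, B₂.indicator 1 (swapAt σ z)) * 2 ^ k ∂π := by
          rw [lintegral_mul_const', lintegral_finsetSum]
          · exact fun σ _ => (measurable_one.indicator hB₂).comp
              (measurePreserving_swapAt D σ).measurable
          · simp
      _ ≤ ∫⁻ _z, (W * 2 ^ n : ℝ≥0∞) ∂π := by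
          refine lintegral_mono fun z => ?_
          have : (∑ σ : Fin n → Bool, B₂.indicator (1 : (Fin n → X × X) → ℝ≥0∞)
              (swapAt σ z)) = (#{σ : Fin n → Bool | swapAt σ z ∈ B₂} : ℝ≥0∞) := by
            simp [Set.indicator_apply]
          rw [this]
          refine le_trans (le_of_eq ?_)
            (((Nat.cast_le (α := ℝ≥0∞)).2 (hcount z)).trans (le_of_eq ?_))
          · push_cast
            congr!
          · push_cast
            rfl
      _ = W * 2 ^ n := by simp [π]
  have h3 : π B₂ ≤ W / 2 ^ k := by
    rw [ENNReal.le_div_iff_mul_le (by simp) (by simp)]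
    rw [mul_assoc, mul_comm (W : ℝ≥0∞)] at h2
    exact (ENNReal.mul_le_mul_iff_right (by simp) (by simp)).1 h2
  calc μ B ≤ 2 * π B₂ := h1
    _ ≤ 2 * (W / 2 ^ k) := by gcongr
    _ = _ := by rw [mul_div_assoc]

end EpsNet

lemma WellBehaved.prodClass {X₁ X₂ : Type*} [MeasurableSpace X₁] [MeasurableSpace X₂]
    {C₁ : Set (Set X₁)} {C₂ : Set (Set X₂)} (h₁ : WellBehaved C₁) (h₂ : WellBehaved C₂) :
    WellBehaved (prodClass C₁ C₂) := by
  constructor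
  · rintro _ ⟨c₁, hc₁, c₂, hc₂, rfl⟩
    exact (h₁.measurable c₁ hc₁).prod (h₂.measurable c₂ hc₂)
  · obtain ⟨S₁, hS₁, hS₁c, hS₁d⟩ := h₁.separable
    obtain ⟨S₂, hS₂, hS₂c, hS₂d⟩ := h₂.separable
    refine ⟨(fun p : Set X₁ × Set X₂ => p.1 ×ˢ p.2) '' (S₁ ×ˢ S₂), ?_,
      (hS₁c.prod hS₂c).image _, ?_⟩
    · rintro _ ⟨⟨c₁, c₂⟩, ⟨hc₁, hc₂⟩, rfl⟩
      exact ⟨c₁, hS₁ hc₁, c₂, hS₂ hc₂, rfl⟩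
    · rintro _ ⟨c₁, hc₁, c₂, hc₂, rfl⟩
      obtain ⟨s₁, hs₁, ht₁⟩ := hS₁d c₁ hc₁
      obtain ⟨s₂, hs₂, ht₂⟩ := hS₂d c₂ hc₂
      refine ⟨fun n => s₁ n ×ˢ s₂ n, fun n => ⟨(s₁ n, s₂ n), ⟨hs₁ n, hs₂ n⟩, rfl⟩, fun x => ?_⟩
      filter_upwards [ht₁ x.1, ht₂ x.2] with n hn₁ hn₂
      simp [Set.mem_prod, hn₁, hn₂]

lemma card_traces_prodClass_le {X₁ X₂ ι : Type*} [Fintype ι] {C₁ : Set (Set X₁)}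
    {C₂ : Set (Set X₂)} {d₁ d₂ : ℕ} (h₁ : vcDim C₁ ≤ d₁) (h₂ : vcDim C₂ ≤ d₂)
    (q : ι → X₁ × X₂) : (traces q (prodClass C₁ C₂)).card ≤
      sauer d₁ (Fintype.card ι) * sauer d₂ (Fintype.card ι) := by
  have : traces q (prodClass C₁ C₂) ⊆ image₂ (· ∩ ·) (traces (fun i => (q i).1) C₁)
      (traces (fun i => (q i).2) C₂) := by
    intro t ht
    obtain ⟨_, ⟨c₁, hc₁, c₂, hc₂, rfl⟩, rfl⟩ := mem_traces.1 ht
    refine mem_image₂.2 ⟨_, mem_traces.2 ⟨c₁, hc₁, rfl⟩, _, mem_traces.2 ⟨c₂, hc₂, rfl⟩, ?_⟩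
    ext i
    simp [Set.mem_prod]
  exact (card_le_card this).trans ((card_image₂_le _ _ _).trans
    (Nat.mul_le_mul (card_traces_le _ h₁) (card_traces_le _ h₂)))

/-- The choice of the sample size: `n ≥ 60 ((d₁ + d₂) log (2/ε) + log (2/δ)) / ε` and
`k = ⌈ε n / 4⌉` suit `measure_exists_missed_le`. -/
lemma sample_bounds {ε δ : ℝ} (hε : 0 < ε) (hε1 : ε < 1) (hδ : 0 < δ) (hδ1 : δ < 1) {d₁ d₂ n : ℕ}
    (hn : 60 * ((d₁ + d₂ : ℝ) * Real.log (2 / ε) + Real.log (2 / δ)) / ε ≤ n) :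
    ∃ k : ℕ, (2 : ℝ) ^ k * (1 - ε / 2) ^ n ≤ 1 / 2 ∧
      2 * ((sauer d₁ (n * 2) : ℝ) * sauer d₂ (n * 2)) / 2 ^ k ≤ δ / 2 := by
  have hl2 := Real.log_two_gt_d9
  have hl2' := Real.log_two_lt_d9
  have hlε : Real.log 2 ≤ Real.log (2 / ε) :=
    Real.log_le_log (by norm_num) (by rw [le_div_iff₀ hε]; linarith)
  have hlδ : Real.log 2 ≤ Real.log (2 / δ) :=
    Real.log_le_log (by norm_num) (by rw [le_div_iff₀ hδ]; linarith)
  set l := Real.log (2 / ε)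
  set r := Real.log (2 / δ)
  rw [div_le_iff₀ hε, mul_comm (n : ℝ)] at hn
  set y := ε * n with hy
  have hd : (0 : ℝ) ≤ (d₁ + d₂ : ℝ) * l := by
    have : 0 ≤ l := by linarith
    positivity
  have hk1 : y / 4 ≤ ⌈y / 4⌉₊ := Nat.le_ceil _
  have hk2 : (⌈y / 4⌉₊ : ℝ) < y / 4 + 1 := Nat.ceil_lt_add_one (by linarith)
  set k := ⌈y / 4⌉₊
  have h2k : (2 : ℝ) ^ k = Real.exp (k * Real.log 2) := by
    rw [Real.exp_nat_mul, Real.exp_log (by norm_num)]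
  refine ⟨k, ?_, ?_⟩
  · have h1 : (1 - ε / 2) ^ n ≤ Real.exp (-(y / 2)) := by
      have := Real.add_one_le_exp (-(ε / 2))
      calc (1 - ε / 2) ^ n ≤ Real.exp (-(ε / 2)) ^ n :=
            pow_le_pow_left₀ (by linarith) (by linarith) n
        _ = _ := by rw [← Real.exp_nat_mul, hy]; ring_nf
    have h2 : (1 / 2 : ℝ) = Real.exp (-Real.log 2) := by
      rw [Real.exp_neg, Real.exp_log (by norm_num)]; norm_num
    calc (2 : ℝ) ^ k * (1 - ε / 2) ^ n ≤ 2 ^ k * Real.exp (-(y / 2)) := by gcongr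
      _ = Real.exp (k * Real.log 2 - y / 2) := by rw [h2k, ← Real.exp_add]; ring_nf
      _ ≤ 1 / 2 := by
        rw [h2]
        refine Real.exp_le_exp.2 ?_
        nlinarith
  · have hx : 0 < ε / 64 := by positivity
    have hs := fun d => sauer_le_exp d (n * 2) hx (by linarith)
    have h64 : 1 / (ε / 64) = Real.exp (5 * Real.log 2 + l) := by
      rw [Real.exp_add, Real.exp_log (by positivity),
        show (5 : ℝ) * Real.log 2 = (5 : ℕ) * Real.log 2 by norm_num, Real.exp_nat_mul,
        Real.exp_log (by norm_num)]
      field_simp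
      norm_num
    have hW : (sauer d₁ (n * 2) : ℝ) * sauer d₂ (n * 2) ≤
        Real.exp ((d₁ + d₂ : ℝ) * (5 * Real.log 2 + l) + y / 16) := by
      refine (mul_le_mul (hs d₁) (hs d₂) (by positivity) (by positivity)).trans (le_of_eq ?_)
      rw [h64, ← Real.exp_nat_mul, ← Real.exp_nat_mul, ← Real.exp_add, ← Real.exp_add,
        ← Real.exp_add]
      push_cast
      rw [hy]
      ring_nf
    have hδ2 : δ / 2 = Real.exp (-r) := by
      rw [Real.exp_neg, Real.exp_log (by positivity)]; field_simp
    have h5 : (d₁ + d₂ : ℝ) * (5 * Real.log 2 + l) ≤ 6 * ((d₁ + d₂ : ℝ) * l) := by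
      have : (d₁ + d₂ : ℝ) * (5 * Real.log 2 + l) ≤ (d₁ + d₂ : ℝ) * (6 * l) := by
        gcongr
        linarith
      linarith
    calc 2 * ((sauer d₁ (n * 2) : ℝ) * sauer d₂ (n * 2)) / 2 ^ k
        ≤ 2 * Real.exp ((d₁ + d₂ : ℝ) * (5 * Real.log 2 + l) + y / 16) / 2 ^ k := by gcongr
      _ = Real.exp (Real.log 2 + ((d₁ + d₂ : ℝ) * (5 * Real.log 2 + l) + y / 16) -
            k * Real.log 2) := by
          rw [Real.exp_sub, Real.exp_add (Real.log 2), Real.exp_log (by norm_num), h2k]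
      _ ≤ δ / 2 := by
        rw [hδ2]
        refine Real.exp_le_exp.2 ?_
        nlinarith

/-- With high probability over a sample of size `n`, all concepts that agree with the target on the
sample have small error. The exceptional set is enclosed in a measurable one: by separability it is
enough to consider countably many concepts. -/
lemma exists_measurable_bad_le {X₁ X₂ : Type*} [MeasurableSpace X₁] [MeasurableSpace X₂]
    {C₁ : Set (Set X₁)} {C₂ : Set (Set X₂)} (hC₁ : WellBehaved C₁) (hC₂ : WellBehaved C₂)
    {d₁ d₂ : ℕ} (h₁ : vcDim C₁ ≤ d₁) (h₂ : vcDim C₂ ≤ d₂)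
    (D : Measure (X₁ × X₂)) [IsProbabilityMeasure D] {c : Set (X₁ × X₂)}
    (hc : c ∈ prodClass C₁ C₂) {ε δ : ℝ} (hε : 0 < ε) (hε1 : ε < 1) (hδ : 0 < δ) (hδ1 : δ < 1)
    {n : ℕ} (hn : 60 * ((d₁ + d₂ : ℝ) * Real.log (2 / ε) + Real.log (2 / δ)) / ε ≤ n) :
    ∃ B : Set (Fin n → X₁ × X₂), MeasurableSet B ∧
      Measure.pi (fun _ => D) B ≤ ENNReal.ofReal (δ / 2) ∧
      ∀ x ∉ B, ∀ h ∈ prodClass C₁ C₂, (∀ i, x i ∈ h ↔ x i ∈ c) →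
        D (symmDiff h c) ≤ ENNReal.ofReal ε := by
  have hC := hC₁.prodClass hC₂
  obtain ⟨S, hSC, hSc, hSd⟩ := hC.separable
  let ℰ : Set (Set (X₁ × X₂)) := (symmDiff · c) '' S ∩ {e | ε < D.real e}
  have hℰc : ℰ.Countable := (hSc.image _).mono Set.inter_subset_left
  have hℰm : ∀ e ∈ ℰ, MeasurableSet e := by
    rintro _ ⟨⟨s, hs, rfl⟩, -⟩
    exact (hC.measurable s (hSC hs)).symmDiff (hC.measurable c hc)
  obtain ⟨k, hk, hkW⟩ := sample_bounds hε hε1 hδ hδ1 hn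
  refine ⟨{x | ∃ e ∈ ℰ, ∀ i, x i ∉ e}, ?_, ?_, ?_⟩
  · have : {x : Fin n → X₁ × X₂ | ∃ e ∈ ℰ, ∀ i, x i ∉ e} =
        ⋃ e ∈ ℰ, ⋂ i, {x : Fin n → X₁ × X₂ | x i ∉ e} := by ext; simp
    rw [this]
    exact MeasurableSet.biUnion hℰc fun e he => MeasurableSet.iInter fun i =>
      (measurable_pi_apply i (hℰm e he)).compl
  · have hW : ∀ q : Fin n × Bool → X₁ × X₂,
        (traces q ℰ).card ≤ sauer d₁ (n * 2) * sauer d₂ (n * 2) := by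
      intro q
      have hsub : traces q ℰ ⊆ (traces q (prodClass C₁ C₂)).image (symmDiff · (trace q c)) := by
        intro t ht
        obtain ⟨_, ⟨⟨s, hs, rfl⟩, -⟩, rfl⟩ := mem_traces.1 ht
        refine mem_image.2 ⟨_, mem_traces.2 ⟨s, hSC hs, rfl⟩, ?_⟩
        ext i
        simp [Finset.mem_symmDiff, Set.mem_symmDiff]
      have := card_traces_prodClass_le h₁ h₂ q
      simp only [Fintype.card_prod, Fintype.card_fin, Fintype.card_bool] at this
      exact (card_le_card hsub).trans (card_image_le.trans this)
    refine (measure_exists_missed_le D hℰc hℰm (fun e he => he.2.le) hk hW).trans ?_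
    refine le_trans (le_of_eq ?_) (ENNReal.ofReal_le_ofReal hkW)
    rw [ENNReal.ofReal_div_of_pos (by positivity), ENNReal.ofReal_mul (by norm_num),
      ENNReal.ofReal_mul (by positivity), ENNReal.ofReal_pow (by norm_num)]
    simp
  · intro x hx h hh hcons
    by_contra! hlt
    obtain ⟨s, hs, hst⟩ := hSd h hh
    have hlim : Filter.Tendsto (fun n => D (symmDiff (s n) c)) Filter.atTop
        (nhds (D (symmDiff h c))) := by
      refine tendsto_measure_of_tendsto_indicator_of_isFiniteMeasure Filter.atTop
        (A := symmDiff h c) (As := fun n => symmDiff (s n) c) D ?_ fun x => ?_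
      · exact fun n => (hC.measurable _ (hSC (hs n))).symmDiff (hC.measurable c hc)
      · filter_upwards [hst x] with n hn
        simp [Set.mem_symmDiff, hn]
    have h3 : ∀ᶠ j in Filter.atTop, ∀ i, (x i ∈ s j ↔ x i ∈ h) :=
      Filter.eventually_all.2 fun i => hst (x i)
    obtain ⟨j, hj, hj'⟩ := ((hlim.eventually_const_lt hlt).and h3).exists
    refine hx ⟨symmDiff (s j) c, ⟨⟨s j, hs j, rfl⟩, ?_⟩, fun i hi => ?_⟩
    · exact (ENNReal.ofReal_lt_iff_lt_toReal hε.le (measure_ne_top _ _)).1 hj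
    · simp [Set.mem_symmDiff, hj' i, hcons i] at hi

/-! ### Success probability and running time of learners -/

namespace Learner

section

variable {X Y H H' : Type*}

/-- The probability, over the internal randomness only, that the algorithm outputs a hypothesis
with property `G` and draws no examples. -/
def randProb (G : H → Prop) : Learner X H → ℝ≥0∞
  | ret none => 0
  | ret (some h) => if G h then 1 else 0
  | tick A => A.randProb G
  | draw _ => 0
  | rand n k => (∑ i, (k i).randProb G) / ((n + 1 : ℕ) : ℝ≥0∞)

@[simp] lemma randProb_tick_iterate (G : H → Prop) (n : ℕ) (A : Learner X H) :
    (tick^[n] A).randProb G = A.randProb G := by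
  induction n with
  | zero => rfl
  | succ n ih => rw [Function.iterate_succ_apply', randProb, ih]

lemma randProb_le_successProb [MeasurableSpace X] (D : Measure X) (c : Set X) (G : H → Prop)
    (A : Learner X H) : A.randProb G ≤ A.successProb D c G := by
  induction A with
  | ret o => cases o <;> simp [randProb, successProb]
  | tick A ih => exact ih
  | draw k ih => exact zero_le
  | rand n k ih => exact ENNReal.div_le_div_right (Finset.sum_le_sum fun i _ => ih i) _

lemma randProb_le_successProbOn (x : ℕ → X) (c : Set X) (G : ℕ → H → Prop) (A : Learner X H)
    (t : ℕ) : A.randProb (G t) ≤ A.successProbOn x c G t := by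
  induction A with
  | ret o => cases o <;> simp [randProb, successProbOn]
  | tick A ih => exact ih
  | draw k ih => exact zero_le
  | rand n k ih => exact ENNReal.div_le_div_right (Finset.sum_le_sum fun i _ => ih i) _

lemma le_sum_div {n : ℕ} {r : ℝ≥0∞} {f : Fin (n + 1) → ℝ≥0∞} (h : ∀ i, r ≤ f i) :
    r ≤ (∑ i, f i) / ((n + 1 : ℕ) : ℝ≥0∞) := by
  rw [ENNReal.le_div_iff_mul_le (Or.inl (by simp)) (Or.inl (by simp)), mul_comm]
  calc ((n + 1 : ℕ) : ℝ≥0∞) * r = ∑ _i : Fin (n + 1), r := by simp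
    _ ≤ _ := Finset.sum_le_sum fun i _ => h i

lemma le_randProb_simulate {n : ℕ} {e : Fin (n + 1) → X × Bool} {k : Option H → Learner Y H'}
    {G : H' → Prop} {r : ℝ≥0∞} (h : ∀ o, r ≤ (k o).randProb G) (A : Learner X H) :
    r ≤ (A.simulate n e k).randProb G := by
  induction A with
  | ret o => exact h o
  | tick A ih => exact ih
  | draw f ih => exact le_sum_div fun i => ih _ _
  | rand m f ih => exact le_sum_div fun i => ih i

lemma lintegral_dirac_le [MeasurableSpace X] (f : X → ℝ≥0∞) (a : X) :
    ∫⁻ x, f x ∂Measure.dirac a ≤ f a := by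
  obtain ⟨g, hg, hgf, h⟩ := exists_measurable_le_lintegral_eq (Measure.dirac a) f
  rw [h, lintegral_dirac' a hg]
  exact hgf a

/-- The uniform distribution on the points `q 0, …, q n`, with multiplicities. -/
def uniform [MeasurableSpace X] {n : ℕ} (q : Fin (n + 1) → X) : Measure X :=
  ((n + 1 : ℕ) : ℝ≥0∞)⁻¹ • ∑ i, Measure.dirac (q i)

instance [MeasurableSpace X] {n : ℕ} (q : Fin (n + 1) → X) :
    IsProbabilityMeasure (uniform q) := by
  constructor
  simp only [uniform, Measure.smul_apply, Measure.finsetSum_apply, measure_univ, smul_eq_mul]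
  simp only [Finset.sum_const, Finset.card_univ, Fintype.card_fin, nsmul_eq_mul, mul_one]
  exact ENNReal.inv_mul_cancel (by simp) (by simp)

lemma inv_le_uniform [MeasurableSpace X] {n : ℕ} (q : Fin (n + 1) → X) {i : Fin (n + 1)}
    {s : Set X} (h : q i ∈ s) : ((n + 1 : ℕ) : ℝ≥0∞)⁻¹ ≤ uniform q s := by
  simp only [uniform, Measure.smul_apply, Measure.finsetSum_apply, smul_eq_mul]
  refine le_mul_of_one_le_right zero_le ?_
  refine le_trans ?_ (Finset.single_le_sum (f := fun j => Measure.dirac (q j) s)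
    (fun _ _ => zero_le) (Finset.mem_univ i))
  exact (Set.indicator_of_mem h (1 : X → ℝ≥0∞)).ge.trans Measure.le_dirac_apply

lemma successProb_uniform_mul_le [MeasurableSpace X] {n : ℕ} {e : Fin (n + 1) → X × Bool}
    {k : Option H → Learner Y H'} {G : H' → Prop} {G₀ : H → Prop} {r : ℝ≥0∞} {c : Set X}
    (he : ∀ i, (e i).2 = true ↔ (e i).1 ∈ c)
    (h : ∀ h, G₀ h → r ≤ (k (some h)).randProb G) (A : Learner X H) :
    A.successProb (uniform fun i => (e i).1) c G₀ * r ≤ (A.simulate n e k).randProb G := by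
  induction A with
  | ret o =>
    cases o with
    | none => simp [successProb]
    | some o =>
      simp only [successProb]
      split_ifs with ho
      · rw [one_mul]; exact h o ho
      · simp
  | tick A ih => exact ih
  | draw f ih =>
    simp only [successProb, simulate, randProb]
    rw [uniform, lintegral_smul_measure, lintegral_finsetSum_measure, smul_eq_mul, mul_assoc,
      ENNReal.div_eq_inv_mul, Finset.sum_mul]
    refine mul_le_mul_right (Finset.sum_le_sum fun i _ => ?_) _
    refine (mul_le_mul_left (lintegral_dirac_le _ _) _).trans ?_
    have : decide ((e i).1 ∈ c) = (e i).2 := by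
      rw [Bool.eq_iff_iff, decide_eq_true_iff, he]
    refine le_trans (le_of_eq ?_) (ih (e i).1 (e i).2)
    rw [← this]
    congr!
  | rand m f ih =>
    simp only [successProb, simulate, randProb]
    rw [ENNReal.div_eq_inv_mul, ENNReal.div_eq_inv_mul, mul_assoc, Finset.sum_mul]
    exact mul_le_mul_right (Finset.sum_le_sum fun i _ => ih i) _

@[simp] lemma time_tick_iterate (n : ℕ) (A : Learner X H) : (tick^[n] A).time = n + A.time := by
  induction n with
  | zero => simp
  | succ n ih => rw [Function.iterate_succ_apply', time, ih]; push_cast; ring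

@[simp] lemma draws_tick_iterate (n : ℕ) (A : Learner X H) : (tick^[n] A).draws = A.draws := by
  induction n with
  | zero => rfl
  | succ n ih => rw [Function.iterate_succ_apply', draws, ih]

lemma time_simulate_le {n : ℕ} {e : Fin (n + 1) → X × Bool} {k : Option H → Learner Y H'}
    {t : ℕ∞} (h : ∀ o, (k o).time ≤ t) (A : Learner X H) :
    (A.simulate n e k).time ≤ A.time + t := by
  induction A with
  | ret o => simp only [simulate, time]; gcongr; exact h o
  | tick A ih => simp only [simulate, time]; rw [add_assoc]; gcongr
  | draw f ih =>
    simp only [simulate, time]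
    rw [add_assoc]
    gcongr
    refine iSup_le fun i => (ih _ _).trans ?_
    gcongr
    exact le_iSup₂ (f := fun x b => (f x b).time) _ _
  | rand m f ih =>
    simp only [simulate, time]
    rw [add_assoc]
    gcongr
    refine iSup_le fun i => (ih i).trans ?_
    gcongr
    exact le_iSup (fun i => (f i).time) i

lemma draws_simulate_eq_zero {n : ℕ} {e : Fin (n + 1) → X × Bool} {k : Option H → Learner Y H'}
    (h : ∀ o, (k o).draws = 0) (A : Learner X H) : (A.simulate n e k).draws = 0 := by
  induction A with
  | ret o => exact h o
  | tick A ih => exact ih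
  | draw f ih => simp only [simulate, draws, ih, ciSup_const]
  | rand m f ih => simp only [simulate, draws, ih, ciSup_const]

lemma one_le_time (A : Learner X H) : 1 ≤ A.time := by
  cases A <;> simp [time]

lemma successProb_le_one [MeasurableSpace X] (D : Measure X) [IsProbabilityMeasure D] (c : Set X)
    (G : H → Prop) (A : Learner X H) : A.successProb D c G ≤ 1 := by
  induction A with
  | ret o =>
    cases o with
    | none => simp [successProb]
    | some o => simp only [successProb]; split_ifs <;> simp
  | tick A ih => exact ih
  | draw k ih =>
    calc _ ≤ ∫⁻ _x, 1 ∂D := lintegral_mono fun x => ih _ _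
      _ = 1 := by simp
  | rand n k ih =>
    refine ENNReal.div_le_of_le_mul ?_
    calc _ ≤ ∑ _i : Fin (n + 1), (1 : ℝ≥0∞) := Finset.sum_le_sum fun i _ => ih i
      _ = _ := by simp

/-- An algorithm that makes few steps is unlikely to see the rare point `z`, and as long as it sees
only `y` it cannot tell the targets `c` and `c'` apart. -/
lemma successProb_add_successProb_le [MeasurableSpace X] {y z : X} {c c' : Set X}
    (hy : y ∈ c ↔ y ∈ c') {a b : ℝ≥0∞} (hab : a + b = 1) {G G' : H → Prop}
    (hG : ∀ h, G h → ¬ G' h) (A : Learner X H) (t : ℕ) (ht : A.time ≤ t) :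
    A.successProb (a • Measure.dirac y + b • Measure.dirac z) c G +
      A.successProb (a • Measure.dirac y + b • Measure.dirac z) c' G' ≤ 1 + t * b := by
  set D := a • Measure.dirac y + b • Measure.dirac z with hD
  have : IsProbabilityMeasure D := ⟨by simp [hD, hab]⟩
  have hdraw : ∀ f : X → ℝ≥0∞, ∫⁻ x, f x ∂D ≤ a * f y + b * f z := fun f => by
    rw [hD, lintegral_add_measure, lintegral_smul_measure, lintegral_smul_measure]
    exact add_le_add (mul_le_mul_right (lintegral_dirac_le _ _) _)
      (mul_le_mul_right (lintegral_dirac_le _ _) _)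
  induction A generalizing t with
  | ret o =>
    cases o with
    | none => simp [successProb]
    | some o =>
      refine le_add_right ?_
      simp only [successProb]
      by_cases h : G o
      · simp [h, hG o h]
      · simp only [h, if_false, zero_add]; split_ifs <;> simp
  | tick A ih => exact ih t (le_trans (by simp [time]) ht)
  | draw k ih =>
    obtain _ | t := t
    · have := (one_le_time (draw k)).trans ht
      simp at this
    · have ht' : ∀ x b, (k x b).time ≤ t := by
        intro x b
        have h1 : 1 + (k x b).time ≤ 1 + t := by
          refine le_trans ?_ (ht.trans (by push_cast; rw [add_comm]))
          simp only [time]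
          gcongr
          exact le_iSup₂ (f := fun x b => (k x b).time) x b
        exact (ENat.add_le_add_iff_left (by simp)).1 h1
      simp only [successProb]
      have hdec : decide (y ∈ c') = decide (y ∈ c) := by simp [hy]
      refine (add_le_add (hdraw _) (hdraw _)).trans ?_
      rw [hdec]
      set b₀ := decide (y ∈ c)
      have hle := ih y b₀ t (ht' _ _)
      have h1 := successProb_le_one D c G (k z (decide (z ∈ c)))
      have h2 := successProb_le_one D c' G' (k z (decide (z ∈ c')))
      calc a * (k y b₀).successProb D c G + b * (k z (decide (z ∈ c))).successProb D c G +
            (a * (k y b₀).successProb D c' G' + b * (k z (decide (z ∈ c'))).successProb D c' G')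
          = a * ((k y b₀).successProb D c G + (k y b₀).successProb D c' G') +
            (b * (k z (decide (z ∈ c))).successProb D c G +
              b * (k z (decide (z ∈ c'))).successProb D c' G') := by ring
        _ ≤ a * (1 + t * b) + (b * 1 + b * 1) := by gcongr
        _ ≤ a * (1 + t * b) + (b * (1 + t * b) + b * 1) := by
          gcongr
          exact le_self_add
        _ = (a + b) * (1 + t * b) + b := by ring
        _ = 1 + (t + 1 : ℕ) * b := by rw [hab]; push_cast; ring
  | rand n k ih =>
    simp only [successProb]
    rw [← ENNReal.add_div, ← Finset.sum_add_distrib]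
    refine ENNReal.div_le_of_le_mul ?_
    calc _ ≤ ∑ _i : Fin (n + 1), (1 + t * b) := Finset.sum_le_sum fun i _ => ih i t (by
          refine le_trans ?_ ht
          simp only [time]
          exact (le_iSup (fun i => (k i).time) i).trans le_add_self)
      _ = _ := by simp; ring

end

end Learner

/-- A sublearner with accuracy `1 / m`, run on fewer than `m` examples that are labelled by a
concept of the class, finds a concept that is right on all of them. -/
lemma IsPACLearner.le_randProb_simulate {X Y H' : Type*} [MeasurableSpace X] {C : Set (Set X)}
    {A : ℝ → ℝ → Learner X C} (hA : IsPACLearner C A) {c : Set X} (hc : c ∈ C) {m : ℕ} {δ : ℝ}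
    (hδ : 0 < δ) (hδ1 : δ < 1) {n : ℕ} (hn : n + 1 < m) {e : Fin (n + 1) → X × Bool}
    (he : ∀ i, (e i).2 = true ↔ (e i).1 ∈ c) {k : Option C → Learner Y H'} {G : H' → Prop} {η : ℝ}
    (hη : 0 ≤ η)
    (h : ∀ h : C, (∀ i, (e i).1 ∈ h.1 ↔ (e i).2 = true) →
      ENNReal.ofReal (1 - η) ≤ (k (some h)).randProb G) :
    ENNReal.ofReal (1 - (η + δ)) ≤ ((A (1 / m) δ).simulate n e k).randProb G := by
  have hm : (1 : ℝ) < m := by exact_mod_cast (by omega : 1 < m)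
  have hs := hA (1 / m) δ (by positivity) (by rw [div_lt_one (by linarith)]; exact hm) hδ hδ1
    (Learner.uniform fun i => (e i).1) inferInstance c hc
  refine le_trans ?_ (Learner.successProb_uniform_mul_le he (r := ENNReal.ofReal (1 - η))
    (G₀ := fun h => Learner.uniform (fun i => (e i).1) (symmDiff h.1 c) ≤ ENNReal.ofReal (1 / m))
    (fun h' hh' => h h' fun i => ?_) (A (1 / m) δ))
  · refine le_trans ?_ (mul_le_mul_left hs _)
    rw [← ENNReal.ofReal_mul (by linarith)]
    refine ENNReal.ofReal_le_ofReal ?_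
    nlinarith
  · rw [he]
    by_contra hne
    have hmem : (e i).1 ∈ symmDiff h'.1 c := by
      rw [Set.mem_symmDiff]; tauto
    have h2 := (Learner.inv_le_uniform (fun i => (e i).1) hmem).trans hh'
    rw [one_div, ENNReal.ofReal_inv_of_pos (by linarith), ENNReal.ofReal_natCast,
      ENNReal.inv_le_inv, Nat.cast_le] at h2
    omega

/-- A PAC-learner for a class with two concepts that agree at one point and differ at another one
has to draw a number of examples proportional to the inverse accuracy. -/
lemma IsPACLearner.le_time {X : Type*} [MeasurableSpace X] {C : Set (Set X)}
    {A : ℝ → ℝ → Learner X C} (hA : IsPACLearner C A) {c c' : Set X} (hc : c ∈ C) (hc' : c' ∈ C)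
    {y z : X} (hy : y ∈ c ↔ y ∈ c') (hz : ¬ (z ∈ c ↔ z ∈ c')) {m : ℕ} (hm : 2 ≤ m) {δ : ℝ}
    (hδ : 0 < δ) (hδ1 : δ ≤ 1 / 4) : (m : ℕ∞) ≤ 4 * (A (1 / m) δ).time := by
  have hm' : (2 : ℝ) ≤ m := by exact_mod_cast hm
  rcases eq_or_ne (A (1 / m) δ).time ⊤ with htop | htop
  · rw [htop]; simp
  obtain ⟨t, ht⟩ := ENat.ne_top_iff_exists.1 htop
  set a := ENNReal.ofReal (1 - 2 / m)
  set b := ENNReal.ofReal (2 / m)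
  have h2m : 2 / (m : ℝ) ≤ 1 := by rw [div_le_one (by linarith)]; exact hm'
  have hab : a + b = 1 := by
    rw [← ENNReal.ofReal_add (by linarith) (by positivity)]; simp
  set D := a • Measure.dirac y + b • Measure.dirac z with hD
  have hDp : IsProbabilityMeasure D := ⟨by simp [hD, hab]⟩
  have hDz : ∀ s : Set X, z ∈ s → ¬ D s ≤ ENNReal.ofReal (1 / m) := by
    intro s hs hle
    have h1 : b ≤ D s := by
      rw [hD, Measure.add_apply, Measure.smul_apply, Measure.smul_apply, smul_eq_mul, smul_eq_mul]
      refine le_add_left (le_mul_of_one_le_right zero_le ?_)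
      exact (Set.indicator_of_mem hs (1 : X → ℝ≥0∞)).ge.trans Measure.le_dirac_apply
    have h2 := h1.trans hle
    rw [ENNReal.ofReal_le_ofReal_iff (by positivity)] at h2
    have : (1 : ℝ) / m < 2 / m := by gcongr; norm_num
    linarith
  have h1m : 1 / (m : ℝ) < 1 := by rw [div_lt_one (by linarith)]; linarith
  have hs := hA (1 / m) δ (by positivity) h1m hδ (by linarith) D hDp
  have hsum := (add_le_add (hs c hc) (hs c' hc')).trans
    (Learner.successProb_add_successProb_le (z := z) hy hab (fun h hh hh' => ?_) _ t ht.ge)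
  · rw [← ENNReal.ofReal_add (by linarith) (by linarith), ← ENNReal.ofReal_natCast t,
      ← ENNReal.ofReal_mul (by positivity), ← ENNReal.ofReal_one,
      ← ENNReal.ofReal_add (by norm_num) (by positivity),
      ENNReal.ofReal_le_ofReal_iff (by positivity)] at hsum
    have h3 : (1 / 2 : ℝ) ≤ t * (2 / m) := by linarith
    rw [mul_div_assoc', le_div_iff₀ (by linarith)] at h3
    have h4 : (m : ℝ) ≤ (4 * t : ℕ) := by push_cast; linarith
    rw [← ht]
    exact_mod_cast h4
  · have h1 := fun hmem => hDz (symmDiff h.1 c) hmem hh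
    have h2 := fun hmem => hDz (symmDiff h.1 c') hmem hh'
    simp only [Set.mem_symmDiff] at h1 h2
    tauto

/-! ### The procedure -/

/-- The labelled list that asks for a concept that agrees with `τ` on `T`. -/
def pattern {s : ℕ} (T τ : Finset (Fin s)) : List (Fin s × Bool) :=
  T.toList.map fun j => (j, decide (j ∈ τ))

/-- The set `t` of points agrees with all labels of the list `Q`. -/
def Agrees {s : ℕ} (Q : List (Fin s × Bool)) (t : Finset (Fin s)) : Prop :=
  ∀ x ∈ Q, (x.1 ∈ t ↔ x.2 = true)

lemma agrees_pattern {s : ℕ} {T τ u : Finset (Fin s)} :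
    Agrees (pattern T τ) u ↔ T ∩ u = T ∩ τ := by
  simp [Agrees, pattern, Finset.ext_iff]

lemma length_pattern {s : ℕ} (T τ : Finset (Fin s)) : (pattern T τ).length = T.card := by
  simp [pattern]

/-- The constraints on the second concept when the first concept has trace `u`. A point of `u`
has the same label in the product as in the second class. There are no constraints if `u` is
empty, but a sublearner needs some example that is labelled by a concept of the class:
the first point serves, with the guessed label `b`. -/
def secondConstraints {s : ℕ} (lab : Fin s → Bool) (u : Finset (Fin s)) (b : Bool) :
    List (Fin s × Bool) :=
  if u = ∅ then ((List.finRange s).take 1).map fun j => (j, b)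
  else u.toList.map fun j => (j, lab j)

lemma length_secondConstraints_le {s : ℕ} (lab : Fin s → Bool) (u : Finset (Fin s)) (b : Bool) :
    (secondConstraints lab u b).length ≤ s := by
  rw [secondConstraints]
  split_ifs
  · simp
  · simpa using card_le_univ u

lemma secondConstraints_ne_nil {s : ℕ} (hs : 0 < s) (lab : Fin s → Bool) (u : Finset (Fin s))
    (b : Bool) : secondConstraints lab u b ≠ [] := by
  rw [secondConstraints]
  split_ifs with h
  · simp; omega
  · simpa using h

namespace Procedure

variable {s : ℕ}

/-- Evaluate the first-component hypothesis `i` at the points of a list, and pass on the set of the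
points it contains, together with `acc`. -/
def evalList₁ {h₁ h₂ : ℕ} (i : Fin h₁) : List (Fin s) → Finset (Fin s) →
    (Finset (Fin s) → Procedure s h₁ h₂) → Procedure s h₁ h₂
  | [], acc, k => k acc
  | j :: L, acc, k => eval₁ i j fun b => evalList₁ i L (if b then insert j acc else acc) k

/-- Evaluate the second-component hypothesis `i` at the points of a list, and pass on the set of
the points it contains, together with `acc`. -/
def evalList₂ {h₁ h₂ : ℕ} (i : Fin h₂) : List (Fin s) → Finset (Fin s) →
    (Finset (Fin s) → Procedure s h₁ h₂) → Procedure s h₁ h₂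
  | [], acc, k => k acc
  | j :: L, acc, k => eval₂ i j fun b => evalList₂ i L (if b then insert j acc else acc) k

/-- Ask the first sublearner for a concept that agrees with the list `Q`. If it returns one, go on
with `yes` and its trace on the sample, otherwise with `no`. -/
def ask₁ (ε δ : ℝ) (Q : List (Fin s × Bool)) (no : ∀ h₁ h₂, Procedure s h₁ h₂)
    (yes : Finset (Fin s) → ∀ h₁ h₂, Procedure s (h₁ + 1) h₂) (h₁ h₂ : ℕ) : Procedure s h₁ h₂ :=
  match Q with
  | [] => no h₁ h₂
  | a :: L => call₁ ε δ a L (no h₁ h₂) <|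
      evalList₁ (Fin.last h₁) ((a :: L).map Prod.fst) ∅ fun t =>
        if Agrees (a :: L) t then
          evalList₁ (Fin.last h₁) (List.finRange s) ∅ fun u => yes u h₁ h₂
        else no (h₁ + 1) h₂

/-- Ask the second sublearner for a concept that agrees with the list `Q`. If it returns one, stop
with its product with the first-component hypothesis `i`, otherwise go on with `no`. -/
def ask₂ (ε δ : ℝ) {h₁ : ℕ} (i : Fin h₁) (Q : List (Fin s × Bool))
    (no : ∀ h₂, Procedure s h₁ h₂) (h₂ : ℕ) : Procedure s h₁ h₂ :=
  match Q with
  | [] => no h₂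
  | a :: L => call₂ ε δ a L (no h₂) <|
      evalList₂ (Fin.last h₂) ((a :: L).map Prod.fst) ∅ fun t =>
        if Agrees (a :: L) t then ret (some (i, Fin.last h₂)) else no (h₂ + 1)

/-- Try to complete the first-component hypothesis `i`, which has trace `u`, to a product that is
consistent with the labels `lab`. -/
def complete (ε δ : ℝ) (lab : Fin s → Bool) (u : Finset (Fin s)) {h₁ : ℕ} (i : Fin h₁)
    (no : ∀ h₂, Procedure s h₁ h₂) (h₂ : ℕ) : Procedure s h₁ h₂ :=
  if ∀ j, lab j = true → j ∈ u then
    ask₂ ε δ i (secondConstraints lab u true)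
      (ask₂ ε δ i (secondConstraints lab u false) no) h₂
  else no h₂

/-- Enumerate the traces of the first class on the sample, and try to complete each of them. The
traces in `S` have been found already, those outside `S ∪ N` are known not to occur. The first
argument bounds the number of rounds. -/
def search (d B : ℕ) (ε δ : ℝ) (lab : Fin s → Bool) :
    ℕ → Finset (Finset (Fin s)) → Finset (Finset (Fin s)) → ∀ h₁ h₂, Procedure s h₁ h₂
  | 0, _, _, _, _ => ret none
  | f + 1, S, N, h₁, h₂ =>
      ask₁ ε δ (pattern (nextQuery d B S N).1 (nextQuery d B S N).2.1)
        (ask₁ ε δ (pattern (nextQuery d B S N).1 (nextQuery d B S N).2.2)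
          (search d B ε δ lab f S
            (refute (nextQuery d B S N).1 (nextQuery d B S N).2.1 (nextQuery d B S N).2.2 N))
          (fun u h₁ => complete ε δ lab u (Fin.last h₁)
            (search d B ε δ lab f (insert u S) N (h₁ + 1))))
        (fun u h₁ => complete ε δ lab u (Fin.last h₁)
          (search d B ε δ lab f (insert u S) N (h₁ + 1)))
        h₁ h₂

/-- Draw `r` more examples, then search for a consistent product. -/
def drawAll (d B : ℕ) (ε δ : ℝ) : ℕ → {s : ℕ} → (Fin s → Bool) → Procedure s 0 0
  | 0, _, lab => search d B ε δ lab (3 * B) ∅ univ 0 0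
  | r + 1, _, lab =>
      draw fun b => drawAll d B ε δ r (Fin.snoc (α := fun _ => Bool) lab b)

section Run

variable {X₁ X₂ : Type*} {C₁ : Set (Set X₁)} {C₂ : Set (Set X₂)}
  {A₁ : ℝ → ℝ → Learner X₁ C₁} {A₂ : ℝ → ℝ → Learner X₂ C₂}
  {p : Fin s → X₁ × X₂} {h₁ h₂ : ℕ} {g₁ : Fin h₁ → C₁} {g₂ : Fin h₂ → C₂}

lemma toLearner_evalList₁ (i : Fin h₁) (L : List (Fin s)) (acc : Finset (Fin s))
    (k : Finset (Fin s) → Procedure s h₁ h₂) :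
    (evalList₁ i L acc k).toLearner A₁ A₂ p g₁ g₂ = Learner.tick^[L.length]
      ((k (acc ∪ {j ∈ L.toFinset | (p j).1 ∈ (g₁ i).1})).toLearner A₁ A₂ p g₁ g₂) := by
  induction L generalizing acc with
  | nil => simp [evalList₁]
  | cons j L ih =>
    simp only [evalList₁, toLearner, ih, List.length_cons, Function.iterate_succ_apply']
    congr 4
    ext a
    by_cases h : (p j).1 ∈ (g₁ i).1 <;> simp [h] <;> grind

lemma toLearner_evalList₂ (i : Fin h₂) (L : List (Fin s)) (acc : Finset (Fin s))
    (k : Finset (Fin s) → Procedure s h₁ h₂) :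
    (evalList₂ i L acc k).toLearner A₁ A₂ p g₁ g₂ = Learner.tick^[L.length]
      ((k (acc ∪ {j ∈ L.toFinset | (p j).2 ∈ (g₂ i).1})).toLearner A₁ A₂ p g₁ g₂) := by
  induction L generalizing acc with
  | nil => simp [evalList₂]
  | cons j L ih =>
    simp only [evalList₂, toLearner, ih, List.length_cons, Function.iterate_succ_apply']
    congr 4
    ext a
    by_cases h : (p j).2 ∈ (g₂ i).1 <;> simp [h] <;> grind

lemma agrees_filter {X : Type*} (q : Fin s → X) (c : Set X) (Q : List (Fin s × Bool)) :
    Agrees Q (∅ ∪ {j ∈ (Q.map Prod.fst).toFinset | q j ∈ c}) ↔ Agrees Q (trace q c) := by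
  refine forall₂_congr fun x hx => ?_
  have : x.1 ∈ (Q.map Prod.fst).toFinset := by
    rw [List.mem_toFinset]
    exact List.mem_map_of_mem hx
  rw [empty_union, mem_filter, mem_trace]
  simp only [this, true_and]

lemma toLearner_ask₁_cons (ε δ : ℝ) (a : Fin s × Bool) (L : List (Fin s × Bool))
    (no : ∀ h₁ h₂, Procedure s h₁ h₂)
    (yes : Finset (Fin s) → ∀ h₁ h₂, Procedure s (h₁ + 1) h₂) :
    (ask₁ ε δ (a :: L) no yes h₁ h₂).toLearner A₁ A₂ p g₁ g₂ =
      Learner.tick^[L.length + 1] ((A₁ ε δ).simulate L.length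
        (fun i : Fin (a :: L).length => ((p ((a :: L).get i).1).1, ((a :: L).get i).2))
        fun o => match o with
          | none => (no h₁ h₂).toLearner A₁ A₂ p g₁ g₂
          | some h => Learner.tick^[L.length + 1]
              (if Agrees (a :: L) (trace (fun j => (p j).1) h.1) then
                Learner.tick^[s] ((yes (trace (fun j => (p j).1) h.1) h₁ h₂).toLearner A₁ A₂ p
                  (Fin.snoc (α := fun _ => C₁) g₁ h) g₂)
              else (no (h₁ + 1) h₂).toLearner A₁ A₂ p (Fin.snoc (α := fun _ => C₁) g₁ h) g₂)) := by
  simp only [ask₁, toLearner]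
  congr 2
  funext o
  cases o with
  | none => rfl
  | some h =>
    simp only [toLearner_evalList₁, List.length_map, List.length_cons, Fin.snoc_last]
    rw [agrees_filter (fun j => (p j).1) h.1 (a :: L)]
    split_ifs
    · rw [toLearner_evalList₁, List.length_finRange]
      congr 4
      ext j
      simp
    · rfl

lemma toLearner_ask₂_cons (ε δ : ℝ) (i : Fin h₁) (a : Fin s × Bool) (L : List (Fin s × Bool))
    (no : ∀ h₂, Procedure s h₁ h₂) :
    (ask₂ ε δ i (a :: L) no h₂).toLearner A₁ A₂ p g₁ g₂ =
      Learner.tick^[L.length + 1] ((A₂ ε δ).simulate L.length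
        (fun i : Fin (a :: L).length => ((p ((a :: L).get i).1).2, ((a :: L).get i).2))
        fun o => match o with
          | none => (no h₂).toLearner A₁ A₂ p g₁ g₂
          | some h => Learner.tick^[L.length + 1]
              (if Agrees (a :: L) (trace (fun j => (p j).2) h.1) then
                .ret (some ⟨(g₁ i).1 ×ˢ h.1, (g₁ i).1, (g₁ i).2, h.1, h.2, rfl⟩)
              else (no (h₂ + 1)).toLearner A₁ A₂ p g₁
                (Fin.snoc (α := fun _ => C₂) g₂ h))) := by
  simp only [ask₂, toLearner]
  congr 2
  funext o
  cases o with
  | none => rfl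
  | some h =>
    simp only [toLearner_evalList₂, List.length_map, List.length_cons, Fin.snoc_last]
    rw [agrees_filter (fun j => (p j).2) h.1 (a :: L)]
    split_ifs
    · simp only [toLearner, Fin.snoc_last]
    · rfl

/-! ### Running time of the procedure -/

lemma time_ask₁_le {ε δ : ℝ} {Q : List (Fin s × Bool)} {no : ∀ h₁ h₂, Procedure s h₁ h₂}
    {yes : Finset (Fin s) → ∀ h₁ h₂, Procedure s (h₁ + 1) h₂} {ℓ : ℕ} (hQ : Q.length ≤ ℓ)
    {t : ℕ∞}
    (hno : ∀ h₁ h₂ (g₁ : Fin h₁ → C₁) (g₂ : Fin h₂ → C₂),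
      ((no h₁ h₂).toLearner A₁ A₂ p g₁ g₂).time ≤ t)
    (hyes : ∀ u ∈ traces (fun j => (p j).1) C₁, Q ≠ [] → Agrees Q u →
      ∀ h₁ h₂ (g₁ : Fin (h₁ + 1) → C₁) (g₂ : Fin h₂ → C₂),
      s + ((yes u h₁ h₂).toLearner A₁ A₂ p g₁ g₂).time ≤ t) :
    ((ask₁ ε δ Q no yes h₁ h₂).toLearner A₁ A₂ p g₁ g₂).time ≤
      2 * ℓ + (A₁ ε δ).time + t := by
  cases Q with
  | nil => exact (hno _ _ _ _).trans le_add_self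
  | cons a L =>
    have hℓ : ((L.length + 1 : ℕ) : ℕ∞) ≤ ℓ := by exact_mod_cast hQ
    rw [toLearner_ask₁_cons, Learner.time_tick_iterate]
    refine (add_le_add hℓ (Learner.time_simulate_le (t := ℓ + t) ?_ _)).trans
      (le_of_eq (by ring))
    rintro (_ | h)
    · exact (hno _ _ _ _).trans le_add_self
    · rw [Learner.time_tick_iterate]
      refine add_le_add hℓ ?_
      split_ifs with hag
      · rw [Learner.time_tick_iterate]
        exact hyes _ (mem_traces.2 ⟨h.1, h.2, rfl⟩) (by simp) hag _ _ _ _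
      · exact hno _ _ _ _

lemma time_ask₂_le {ε δ : ℝ} {i : Fin h₁} {Q : List (Fin s × Bool)}
    {no : ∀ h₂, Procedure s h₁ h₂} {ℓ : ℕ} (hQ : Q.length ≤ ℓ) {t : ℕ∞} (ht : 1 ≤ t)
    (hno : ∀ h₂ (g₂ : Fin h₂ → C₂), ((no h₂).toLearner A₁ A₂ p g₁ g₂).time ≤ t) :
    ((ask₂ ε δ i Q no h₂).toLearner A₁ A₂ p g₁ g₂).time ≤ 2 * ℓ + (A₂ ε δ).time + t := by
  cases Q with
  | nil => exact (hno _ _).trans le_add_self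
  | cons a L =>
    have hℓ : ((L.length + 1 : ℕ) : ℕ∞) ≤ ℓ := by exact_mod_cast hQ
    rw [toLearner_ask₂_cons, Learner.time_tick_iterate]
    refine (add_le_add hℓ (Learner.time_simulate_le (t := ℓ + t) ?_ _)).trans
      (le_of_eq (by ring))
    rintro (_ | h)
    · exact (hno _ _).trans le_add_self
    · rw [Learner.time_tick_iterate]
      refine add_le_add hℓ ?_
      split_ifs with hag
      · exact ht
      · exact hno _ _

lemma time_complete_le {ε δ : ℝ} {lab : Fin s → Bool} {u : Finset (Fin s)} {i : Fin h₁}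
    {no : ∀ h₂, Procedure s h₁ h₂} {t : ℕ∞} (ht : 1 ≤ t)
    (hno : ∀ h₂ (g₂ : Fin h₂ → C₂), ((no h₂).toLearner A₁ A₂ p g₁ g₂).time ≤ t) :
    ((complete ε δ lab u i no h₂).toLearner A₁ A₂ p g₁ g₂).time ≤
      4 * s + 2 * (A₂ ε δ).time + t := by
  rw [complete]
  split_ifs
  · refine (time_ask₂_le (length_secondConstraints_le _ _ _) (ht.trans le_add_self)
      fun h₂ g₂ => time_ask₂_le (length_secondConstraints_le _ _ _) ht hno).trans
      (le_of_eq (by ring))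
  · exact (hno _ _).trans le_add_self

/-- Every round costs two queries of size at most `ℓ` to the first sublearner. The more expensive
work, to evaluate a concept on the whole sample and to complete it, is done only once for each
trace of the first class. -/
lemma time_search_le {d B : ℕ} {ε δ : ℝ} {lab : Fin s → Bool} {ℓ : ℕ}
    (hℓ : ∀ S ⊆ traces (fun j => (p j).1) C₁, ∀ N, (nextQuery d B S N).1.card ≤ ℓ) (f : ℕ)
    (S N : Finset (Finset (Fin s))) (hS : S ⊆ traces (fun j => (p j).1) C₁) :
    ((search d B ε δ lab f S N h₁ h₂).toLearner A₁ A₂ p g₁ g₂).time ≤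
      f * (4 * ℓ + 2 * (A₁ ε δ).time) +
        #(traces (fun j => (p j).1) C₁ \ S) * (5 * s + 2 * (A₂ ε δ).time) + 1 := by
  induction f generalizing S N h₁ h₂ with
  | zero => simp [search, toLearner, Learner.time]
  | succ f ih =>
    set F := traces (fun j => (p j).1) C₁ with hF
    rw [search]
    set x := nextQuery d B S N
    have hyes : ∀ τ, (x.1.Nonempty → ∀ v ∈ S, x.1 ∩ v ≠ x.1 ∩ τ) → ∀ u ∈ F,
        pattern x.1 τ ≠ [] → Agrees (pattern x.1 τ) u →
        ∀ h₁ h₂ (g₁ : Fin (h₁ + 1) → C₁) (g₂ : Fin h₂ → C₂),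
        s + ((complete ε δ lab u (Fin.last h₁) (search d B ε δ lab f (insert u S) N
          (h₁ + 1)) h₂).toLearner A₁ A₂ p g₁ g₂).time ≤
        f * (4 * ℓ + 2 * (A₁ ε δ).time) + #(F \ S) * (5 * s + 2 * (A₂ ε δ).time) + 1 := by
      intro τ hτ u hu hne hag h₁ h₂ g₁ g₂
      have hne' : x.1.Nonempty := by
        rw [nonempty_iff_ne_empty]
        rintro h
        simp [pattern, h] at hne
      have huS : u ∉ S := fun h => hτ hne' u h (agrees_pattern.1 hag)
      have hcard : #(F \ S) = #(F \ insert u S) + 1 := by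
        rw [sdiff_insert, card_erase_of_mem (by simp [hu, huS])]
        have := card_pos.2 ⟨u, (mem_sdiff.2 ⟨hu, huS⟩ : u ∈ F \ S)⟩
        omega
      refine (add_le_add le_rfl (time_complete_le le_add_self fun h₂ g₂ =>
        ih (insert u S) N (insert_subset hu hS))).trans (le_of_eq ?_)
      rw [hcard]
      push_cast
      ring
    have hlen : ∀ τ, (pattern x.1 τ).length ≤ ℓ := fun τ => by
      rw [length_pattern]; exact hℓ S hS N
    refine (time_ask₁_le (hlen _) (t := 2 * ℓ + (A₁ ε δ).time + (f * (4 * ℓ + 2 * (A₁ ε δ).time) +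
      #(F \ S) * (5 * s + 2 * (A₂ ε δ).time) + 1)) (fun h₁ h₂ g₁ g₂ => ?_)
      fun u hu hne hag h₁ h₂ g₁ g₂ => ?_).trans (le_of_eq ?_)
    · exact time_ask₁_le (hlen _) (fun h₁ h₂ g₁ g₂ => ih S _ hS)
        (hyes _ fun hne v hv => (nextQuery_fresh d B S N hne v hv).2)
    · exact (hyes _ (fun hne v hv => (nextQuery_fresh d B S N hne v hv).1) u hu hne hag
        h₁ h₂ g₁ g₂).trans le_add_self
    · push_cast
      ring

lemma time_drawAll_le {d B : ℕ} {ε δ : ℝ} {t : ℕ∞} {n : ℕ}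
    (h : ∀ (lab : Fin n → Bool) (p : Fin n → X₁ × X₂) (g₁ : Fin 0 → C₁) (g₂ : Fin 0 → C₂),
      ((search d B ε δ lab (3 * B) ∅ univ 0 0).toLearner A₁ A₂ p g₁ g₂).time ≤ t)
    (r s : ℕ) (hr : s + r = n) (lab : Fin s → Bool) (p : Fin s → X₁ × X₂)
    (g₁ : Fin 0 → C₁) (g₂ : Fin 0 → C₂) :
    ((drawAll d B ε δ r lab).toLearner A₁ A₂ p g₁ g₂).time ≤ r + t := by
  induction r generalizing s with
  | zero =>
    obtain rfl : s = n := hr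
    exact (h lab p g₁ g₂).trans le_add_self
  | succ r ih =>
    simp only [drawAll, toLearner, Learner.time]
    have : ((r + 1 : ℕ) : ℕ∞) + t = 1 + (r + t) := by push_cast; ring
    rw [this]
    gcongr
    exact iSup₂_le fun x b => ih (s + 1) (by omega) _ _

lemma draws_ask₁ {ε δ : ℝ} {Q : List (Fin s × Bool)} {no : ∀ h₁ h₂, Procedure s h₁ h₂}
    {yes : Finset (Fin s) → ∀ h₁ h₂, Procedure s (h₁ + 1) h₂}
    (hno : ∀ h₁ h₂ (g₁ : Fin h₁ → C₁) (g₂ : Fin h₂ → C₂),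
      ((no h₁ h₂).toLearner A₁ A₂ p g₁ g₂).draws = 0)
    (hyes : ∀ u h₁ h₂ (g₁ : Fin (h₁ + 1) → C₁) (g₂ : Fin h₂ → C₂),
      ((yes u h₁ h₂).toLearner A₁ A₂ p g₁ g₂).draws = 0) :
    ((ask₁ ε δ Q no yes h₁ h₂).toLearner A₁ A₂ p g₁ g₂).draws = 0 := by
  cases Q with
  | nil => exact hno _ _ _ _
  | cons a L =>
    rw [toLearner_ask₁_cons, Learner.draws_tick_iterate]
    refine Learner.draws_simulate_eq_zero ?_ _
    rintro (_ | h)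
    · exact hno _ _ _ _
    · rw [Learner.draws_tick_iterate]
      split_ifs
      · rw [Learner.draws_tick_iterate]
        exact hyes _ _ _ _ _
      · exact hno _ _ _ _

lemma draws_ask₂ {ε δ : ℝ} {i : Fin h₁} {Q : List (Fin s × Bool)} {no : ∀ h₂, Procedure s h₁ h₂}
    (hno : ∀ h₂ (g₂ : Fin h₂ → C₂), ((no h₂).toLearner A₁ A₂ p g₁ g₂).draws = 0) :
    ((ask₂ ε δ i Q no h₂).toLearner A₁ A₂ p g₁ g₂).draws = 0 := by
  cases Q with
  | nil => exact hno _ _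
  | cons a L =>
    rw [toLearner_ask₂_cons, Learner.draws_tick_iterate]
    refine Learner.draws_simulate_eq_zero ?_ _
    rintro (_ | h)
    · exact hno _ _
    · rw [Learner.draws_tick_iterate]
      split_ifs
      · rfl
      · exact hno _ _

lemma draws_complete {ε δ : ℝ} {lab : Fin s → Bool} {u : Finset (Fin s)} {i : Fin h₁}
    {no : ∀ h₂, Procedure s h₁ h₂}
    (hno : ∀ h₂ (g₂ : Fin h₂ → C₂), ((no h₂).toLearner A₁ A₂ p g₁ g₂).draws = 0) :
    ((complete ε δ lab u i no h₂).toLearner A₁ A₂ p g₁ g₂).draws = 0 := by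
  rw [complete]
  split_ifs
  · exact draws_ask₂ fun _ _ => draws_ask₂ hno
  · exact hno _ _

lemma draws_search {d B : ℕ} {ε δ : ℝ} {lab : Fin s → Bool} (f : ℕ)
    (S N : Finset (Finset (Fin s))) :
    ((search d B ε δ lab f S N h₁ h₂).toLearner A₁ A₂ p g₁ g₂).draws = 0 := by
  induction f generalizing S N h₁ h₂ with
  | zero => rfl
  | succ f ih =>
    rw [search]
    exact draws_ask₁ (fun _ _ _ _ => draws_ask₁ (fun _ _ _ _ => ih _ _)
      fun _ _ _ _ _ => draws_complete fun _ _ => ih _ _)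
      fun _ _ _ _ _ => draws_complete fun _ _ => ih _ _

lemma draws_drawAll_le {d B : ℕ} {ε δ : ℝ} (r s : ℕ) (lab : Fin s → Bool)
    (p : Fin s → X₁ × X₂) (g₁ : Fin 0 → C₁) (g₂ : Fin 0 → C₂) :
    ((drawAll d B ε δ r lab).toLearner A₁ A₂ p g₁ g₂).draws ≤ r := by
  induction r generalizing s with
  | zero => exact (draws_search _ _ _).le
  | succ r ih =>
    simp only [drawAll, toLearner, Learner.draws]
    rw [Nat.cast_succ, add_comm]
    gcongr
    exact iSup₂_le fun x b => ih (s + 1) _ _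

end Run

end Procedure

/-! ### Success probability of the procedure -/

namespace Procedure

section Prob

variable {s : ℕ} {X₁ X₂ : Type*}
  {C₁ : Set (Set X₁)} {C₂ : Set (Set X₂)}
  {A₁ : ℝ → ℝ → Learner X₁ C₁} {A₂ : ℝ → ℝ → Learner X₂ C₂}
  {p : Fin s → X₁ × X₂} {h₁ h₂ : ℕ} {g₁ : Fin h₁ → C₁} {g₂ : Fin h₂ → C₂}
  {G : prodClass C₁ C₂ → Prop}

lemma le_randProb_ask₁ {ε δ : ℝ} {Q : List (Fin s × Bool)} {no : ∀ h₁ h₂, Procedure s h₁ h₂}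
    {yes : Finset (Fin s) → ∀ h₁ h₂, Procedure s (h₁ + 1) h₂} {r : ℝ≥0∞}
    (hno : ∀ h₁ h₂ (g₁ : Fin h₁ → C₁) (g₂ : Fin h₂ → C₂),
      r ≤ ((no h₁ h₂).toLearner A₁ A₂ p g₁ g₂).randProb G)
    (hyes : ∀ h : C₁, Agrees Q (trace (fun j => (p j).1) h.1) →
      ∀ h₁ h₂ (g₁ : Fin h₁ → C₁) (g₂ : Fin h₂ → C₂),
      r ≤ ((yes (trace (fun j => (p j).1) h.1) h₁ h₂).toLearner A₁ A₂ p
        (Fin.snoc (α := fun _ => C₁) g₁ h) g₂).randProb G) :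
    r ≤ ((ask₁ ε δ Q no yes h₁ h₂).toLearner A₁ A₂ p g₁ g₂).randProb G := by
  cases Q with
  | nil => exact hno _ _ _ _
  | cons a L =>
    rw [toLearner_ask₁_cons, Learner.randProb_tick_iterate]
    refine Learner.le_randProb_simulate ?_ _
    rintro (_ | h)
    · exact hno _ _ _ _
    · rw [Learner.randProb_tick_iterate]
      split_ifs with hag
      · rw [Learner.randProb_tick_iterate]
        exact hyes h hag _ _ _ _
      · exact hno _ _ _ _

lemma agrees_trace_iff {X : Type*} {q : Fin s → X} {c : Set X} {Q : List (Fin s × Bool)} :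
    Agrees Q (trace q c) ↔ ∀ i : Fin Q.length, (Q.get i).2 = true ↔ q (Q.get i).1 ∈ c := by
  constructor
  · intro h i
    rw [← h _ (List.get_mem Q i), mem_trace]
  · intro h x hx
    obtain ⟨i, rfl⟩ := List.mem_iff_get.1 hx
    rw [h, mem_trace]

lemma le_randProb_ask₁_of_agrees [MeasurableSpace X₁] {m : ℕ} {δ η : ℝ} (hA₁ : IsPACLearner C₁ A₁)
    (hδ : 0 < δ)
    (hδ1 : δ < 1) (hη : 0 ≤ η) {Q : List (Fin s × Bool)} (hQ : Q ≠ []) (hQm : Q.length < m)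
    {c : Set X₁} (hc : c ∈ C₁) (hcQ : Agrees Q (trace (fun j => (p j).1) c))
    {no : ∀ h₁ h₂, Procedure s h₁ h₂}
    {yes : Finset (Fin s) → ∀ h₁ h₂, Procedure s (h₁ + 1) h₂}
    (hyes : ∀ h : C₁, Agrees Q (trace (fun j => (p j).1) h.1) →
      ∀ h₁ h₂ (g₁ : Fin h₁ → C₁) (g₂ : Fin h₂ → C₂),
      ENNReal.ofReal (1 - η) ≤ ((yes (trace (fun j => (p j).1) h.1) h₁ h₂).toLearner A₁ A₂ p
        (Fin.snoc (α := fun _ => C₁) g₁ h) g₂).randProb G) :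
    ENNReal.ofReal (1 - (η + δ)) ≤
      ((ask₁ (1 / m) δ Q no yes h₁ h₂).toLearner A₁ A₂ p g₁ g₂).randProb G := by
  cases Q with
  | nil => exact absurd rfl hQ
  | cons a L =>
    rw [toLearner_ask₁_cons, Learner.randProb_tick_iterate]
    refine hA₁.le_randProb_simulate hc hδ hδ1 hQm (agrees_trace_iff.1 hcQ) hη fun h hh => ?_
    have hag : Agrees (a :: L) (trace (fun j => (p j).1) h.1) :=
      agrees_trace_iff.2 fun i => (hh i).symm
    rw [Learner.randProb_tick_iterate, if_pos hag, Learner.randProb_tick_iterate]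
    exact hyes h hag _ _ _ _

lemma le_randProb_ask₂ {ε δ : ℝ} {i : Fin h₁} {Q : List (Fin s × Bool)}
    {no : ∀ h₂, Procedure s h₁ h₂} {r : ℝ≥0∞} (hr : r ≤ 1)
    (hG : ∀ h : prodClass C₁ C₂, (∃ c ∈ C₂, h.1 = (g₁ i).1 ×ˢ c ∧
      Agrees Q (trace (fun j => (p j).2) c)) → G h)
    (hno : ∀ h₂ (g₂ : Fin h₂ → C₂), r ≤ ((no h₂).toLearner A₁ A₂ p g₁ g₂).randProb G) :
    r ≤ ((ask₂ ε δ i Q no h₂).toLearner A₁ A₂ p g₁ g₂).randProb G := by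
  cases Q with
  | nil => exact hno _ _
  | cons a L =>
    rw [toLearner_ask₂_cons, Learner.randProb_tick_iterate]
    refine Learner.le_randProb_simulate ?_ _
    rintro (_ | h)
    · exact hno _ _
    · rw [Learner.randProb_tick_iterate]
      split_ifs with hag
      · rw [Learner.randProb, if_pos (hG _ ⟨h.1, h.2, rfl, hag⟩)]
        exact hr
      · exact hno _ _

lemma le_randProb_ask₂_of_agrees [MeasurableSpace X₂] {m : ℕ} {δ : ℝ} (hA₂ : IsPACLearner C₂ A₂)
    (hδ : 0 < δ)
    (hδ1 : δ < 1) {i : Fin h₁} {Q : List (Fin s × Bool)} (hQ : Q ≠ []) (hQm : Q.length < m)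
    {c : Set X₂} (hc : c ∈ C₂) (hcQ : Agrees Q (trace (fun j => (p j).2) c))
    (hG : ∀ h : prodClass C₁ C₂, (∃ c ∈ C₂, h.1 = (g₁ i).1 ×ˢ c ∧
      Agrees Q (trace (fun j => (p j).2) c)) → G h)
    {no : ∀ h₂, Procedure s h₁ h₂} :
    ENNReal.ofReal (1 - δ) ≤
      ((ask₂ (1 / m) δ i Q no h₂).toLearner A₁ A₂ p g₁ g₂).randProb G := by
  cases Q with
  | nil => exact absurd rfl hQ
  | cons a L =>
    rw [toLearner_ask₂_cons, Learner.randProb_tick_iterate,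
      show 1 - δ = 1 - (0 + δ) by ring]
    refine hA₂.le_randProb_simulate hc hδ hδ1 hQm (agrees_trace_iff.1 hcQ) le_rfl
      fun h hh => ?_
    have hag : Agrees (a :: L) (trace (fun j => (p j).2) h.1) :=
      agrees_trace_iff.2 fun i => (hh i).symm
    rw [Learner.randProb_tick_iterate, if_pos hag, Learner.randProb,
      if_pos (hG _ ⟨h.1, h.2, rfl, hag⟩)]
    simp

/-- If the trace `u` of the first concept contains all positive points, then a second concept that
obeys the constraints makes the product consistent with all labels. -/
lemma consistent_of_agrees {lab : Fin s → Bool} {c₁ : Set X₁} {c₂ : Set X₂} {b : Bool}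
    (hpos : ∀ j, lab j = true → j ∈ trace (fun j => (p j).1) c₁)
    (h : Agrees (secondConstraints lab (trace (fun j => (p j).1) c₁) b)
      (trace (fun j => (p j).2) c₂)) (j : Fin s) : p j ∈ c₁ ×ˢ c₂ ↔ lab j = true := by
  rw [Set.mem_prod]
  by_cases hj : j ∈ trace (fun j => (p j).1) c₁
  · have hne : trace (fun j => (p j).1) c₁ ≠ ∅ := ne_empty_of_mem hj
    rw [secondConstraints, if_neg hne] at h
    have := h (j, lab j) (List.mem_map.2 ⟨j, mem_toList.2 hj, rfl⟩)
    simp only [mem_trace] at this hj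
    rw [← this]
    exact and_iff_right hj
  · refine ⟨fun hh => absurd ((mem_trace (q := fun j => (p j).1)).2 hh.1) hj,
      fun hh => absurd (hpos j hh) hj⟩

lemma le_randProb_complete {ε δ : ℝ} {lab : Fin s → Bool} {i : Fin h₁} {u : Finset (Fin s)}
    (hu : trace (fun j => (p j).1) (g₁ i).1 = u) {no : ∀ h₂, Procedure s h₁ h₂} {r : ℝ≥0∞}
    (hr : r ≤ 1)
    (hG : ∀ h : prodClass C₁ C₂, (∀ j, p j ∈ h.1 ↔ lab j = true) → G h)
    (hno : ∀ h₂ (g₂ : Fin h₂ → C₂), r ≤ ((no h₂).toLearner A₁ A₂ p g₁ g₂).randProb G) :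
    r ≤ ((complete ε δ lab u i no h₂).toLearner A₁ A₂ p g₁ g₂).randProb G := by
  subst hu
  rw [complete]
  split_ifs with hpos
  · have hG' : ∀ b, ∀ h : prodClass C₁ C₂, (∃ c ∈ C₂, h.1 = (g₁ i).1 ×ˢ c ∧
        Agrees (secondConstraints lab (trace (fun j => (p j).1) (g₁ i).1) b)
          (trace (fun j => (p j).2) c)) → G h := by
      rintro b ⟨h, hh⟩ ⟨c, hc, rfl, hag⟩
      exact hG _ (consistent_of_agrees hpos hag)
    exact le_randProb_ask₂ hr (hG' true) fun _ _ => le_randProb_ask₂ hr (hG' false) hno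
  · exact hno _ _

lemma le_randProb_complete_of_trace_eq [MeasurableSpace X₂] {m : ℕ} {δ : ℝ}
    (hA₂ : IsPACLearner C₂ A₂) (hδ : 0 < δ) (hδ1 : δ < 1) (hs : 0 < s) (hsm : s < m)
    {lab : Fin s → Bool} {c₁ : Set X₁} {c₂ : Set X₂}
    (hc₂ : c₂ ∈ C₂) (hlab : ∀ j, lab j = true ↔ p j ∈ c₁ ×ˢ c₂) {i : Fin h₁}
    {u : Finset (Fin s)} (hu : trace (fun j => (p j).1) (g₁ i).1 = u)
    (hi : u = trace (fun j => (p j).1) c₁) {no : ∀ h₂, Procedure s h₁ h₂}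
    (hG : ∀ h : prodClass C₁ C₂, (∀ j, p j ∈ h.1 ↔ lab j = true) → G h) :
    ENNReal.ofReal (1 - δ) ≤
      ((complete (1 / m) δ lab u i no h₂).toLearner A₁ A₂ p g₁ g₂).randProb G := by
  subst hu
  have hpos : ∀ j, lab j = true → j ∈ trace (fun j => (p j).1) (g₁ i).1 := fun j hj => by
    rw [hi, mem_trace]
    exact ((hlab j).1 hj).1
  have hG' : ∀ b, ∀ h : prodClass C₁ C₂, (∃ c ∈ C₂, h.1 = (g₁ i).1 ×ˢ c ∧
      Agrees (secondConstraints lab (trace (fun j => (p j).1) (g₁ i).1) b)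
        (trace (fun j => (p j).2) c)) → G h := by
    rintro b ⟨h, hh⟩ ⟨c, hc, rfl, hag⟩
    exact hG _ (consistent_of_agrees hpos hag)
  -- One of the two guesses for the label of the first point is right.
  have hb : ∃ b, Agrees (secondConstraints lab (trace (fun j => (p j).1) (g₁ i).1) b)
      (trace (fun j => (p j).2) c₂) := by
    by_cases hu : trace (fun j => (p j).1) (g₁ i).1 = ∅
    · obtain ⟨b, hb⟩ : ∃ b : Bool, (p ⟨0, hs⟩).2 ∈ c₂ ↔ b = true := by
        by_cases h : (p ⟨0, hs⟩).2 ∈ c₂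
        · exact ⟨true, by simp [h]⟩
        · exact ⟨false, by simp [h]⟩
      refine ⟨b, ?_⟩
      rw [secondConstraints, if_pos hu]
      obtain ⟨n, rfl⟩ := Nat.exists_eq_succ_of_ne_zero hs.ne'
      simpa [Agrees, List.finRange_succ] using hb
    · refine ⟨true, ?_⟩
      rw [secondConstraints, if_neg hu]
      intro x hx
      obtain ⟨j, hj, rfl⟩ := List.mem_map.1 hx
      rw [mem_toList, hi, mem_trace] at hj
      simp only [mem_trace, hlab, Set.mem_prod, hj, true_and]
  have hlen := fun b => (length_secondConstraints_le lab
    (trace (fun j => (p j).1) (g₁ i).1) b).trans_lt hsm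
  have hne := secondConstraints_ne_nil hs lab (trace (fun j => (p j).1) (g₁ i).1)
  rw [complete, if_pos hpos]
  obtain ⟨_ | _, hb⟩ := hb
  · refine le_randProb_ask₂ (ENNReal.ofReal_le_one.2 (by linarith)) (hG' true) fun h₂ g₂ => ?_
    exact le_randProb_ask₂_of_agrees hA₂ hδ hδ1 (hne _) (hlen _) hc₂ hb (hG' false)
  · exact le_randProb_ask₂_of_agrees hA₂ hδ hδ1 (hne _) (hlen _) hc₂ hb (hG' true)

/-- As long as the sublearners do not fail, the trace of the target remains a candidate, and once
it is found the procedure stops with a consistent product. At most three of the calls of a round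
matter. -/
lemma le_randProb_search [MeasurableSpace X₁] [MeasurableSpace X₂] {m d B : ℕ} {δ : ℝ}
    (hA₁ : IsPACLearner C₁ A₁)
    (hA₂ : IsPACLearner C₂ A₂) (hδ : 0 < δ) (hδ1 : δ < 1) (hs : 0 < s) (hsm : s < m)
    (hd : vcDim C₁ ≤ d) (hB : sauer d s ≤ B) {lab : Fin s → Bool} {c₁ : Set X₁} {c₂ : Set X₂}
    (hc₁ : c₁ ∈ C₁) (hc₂ : c₂ ∈ C₂) (hlab : ∀ j, lab j = true ↔ p j ∈ c₁ ×ˢ c₂)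
    (hG : ∀ h : prodClass C₁ C₂, (∀ j, p j ∈ h.1 ↔ lab j = true) → G h) (f : ℕ)
    (S N : Finset (Finset (Fin s))) (hS : S ⊆ traces (fun j => (p j).1) C₁)
    (hcS : trace (fun j => (p j).1) c₁ ∉ S) (hcN : trace (fun j => (p j).1) c₁ ∈ N)
    (hf : potential d B S N ≤ f) :
    ENNReal.ofReal (1 - 3 * f * δ) ≤
      ((search d B (1 / m) δ lab f S N h₁ h₂).toLearner A₁ A₂ p g₁ g₂).randProb G := by
  have : Nonempty (Fin s) := ⟨⟨0, hs⟩⟩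
  set q : Fin s → X₁ := fun j => (p j).1
  set F := traces q C₁
  have hB' : sauer d (Fintype.card (Fin s)) ≤ B := by rwa [Fintype.card_fin]
  have hF : F.card ≤ B := (card_traces_le q hd).trans hB'
  have hcF : trace q c₁ ∈ F := mem_traces.2 ⟨c₁, hc₁, rfl⟩
  induction f generalizing S N h₁ h₂ with
  | zero =>
    have hmem : trace q c₁ ∈ prune d S N := mem_filter.2 ⟨hcN, hcS, fun T hT =>
      card_le_of_shatters_traces hd (hT.mono_left (insert_subset hcF hS))⟩
    have := potential_pos ((sauer_pos _ _).trans_le hB) ⟨_, hmem⟩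
    omega
  | succ f ih =>
    have hmem : trace q c₁ ∈ prune d S N := mem_filter.2 ⟨hcN, hcS, fun T hT =>
      card_le_of_shatters_traces hd (hT.mono_left (insert_subset hcF hS))⟩
    have hq := nextQuery_spec (exists_query hB' ⟨_, hmem⟩)
    rw [search]
    set x := nextQuery d B S N
    have hfδ : 0 ≤ 3 * f * δ := by positivity
    have hyes : ∀ τ, (∀ v ∈ S, x.1 ∩ v ≠ x.1 ∩ τ) → ∀ h : C₁,
        Agrees (pattern x.1 τ) (trace q h.1) →
        ∀ h₁ h₂ (g₁ : Fin h₁ → C₁) (g₂ : Fin h₂ → C₂),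
        ENNReal.ofReal (1 - (3 * f * δ + δ)) ≤
          ((complete (1 / m) δ lab (trace q h.1) (Fin.last h₁)
            (search d B (1 / m) δ lab f (insert (trace q h.1) S) N (h₁ + 1)) h₂).toLearner A₁ A₂ p
            (Fin.snoc (α := fun _ => C₁) g₁ h) g₂).randProb G := by
      intro τ hτ h hag h₁ h₂ g₁ g₂
      have hlast : trace (fun j => (p j).1)
          (Fin.snoc (α := fun _ => C₁) g₁ h (Fin.last h₁)).1 = trace q h.1 := by
        rw [Fin.snoc_last]
      have huS : trace q h.1 ∉ S := fun hu => hτ _ hu (agrees_pattern.1 hag)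
      have hins : insert (trace q h.1) S ⊆ F :=
        insert_subset (mem_traces.2 ⟨h.1, h.2, rfl⟩) hS
      by_cases heq : trace q h.1 = trace q c₁
      · exact (ENNReal.ofReal_le_ofReal (by linarith)).trans
          (le_randProb_complete_of_trace_eq hA₂ hδ hδ1 hs hsm hc₂ hlab hlast heq hG)
      · refine (ENNReal.ofReal_le_ofReal (q := 1 - 3 * f * δ) (by linarith)).trans
          (le_randProb_complete hlast (ENNReal.ofReal_le_one.2 (by linarith)) hG
            fun h₂ g₂ => ih _ _ ?_ ?_ hcN hins)
        · have := potential_insert_lt (d := d) (N := N) huS ((card_le_card hins).trans hF)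
          omega
        · rw [mem_insert, not_or]
          exact ⟨Ne.symm heq, hcS⟩
    have hlen : ∀ τ, (pattern x.1 τ).length < m := fun τ => by
      rw [length_pattern]
      exact (card_le_univ _).trans_lt (by simpa using hsm)
    have hne : ∀ τ, pattern x.1 τ ≠ [] := fun τ h => by
      have := congrArg List.length h
      rw [length_pattern, List.length_nil, card_eq_zero] at this
      exact hq.nonempty.ne_empty this
    have e1 : 1 - 3 * ((f + 1 : ℕ) : ℝ) * δ ≤ 1 - ((3 * f * δ + δ) + δ) := by
      push_cast
      linarith
    have e2 : 1 - ((3 * f * δ + δ) + δ) ≤ 1 - (3 * f * δ + δ) := by linarith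
    have hη : 0 ≤ 3 * f * δ + δ := by linarith
    refine (ENNReal.ofReal_le_ofReal e1).trans ?_
    by_cases hQ : Agrees (pattern x.1 x.2.1) (trace q c₁)
    · exact le_randProb_ask₁_of_agrees hA₁ hδ hδ1 hη (hne _) (hlen _) hc₁ hQ
        (hyes _ fun v hv => (hq.fresh v hv).1)
    refine le_randProb_ask₁ (fun h₁ h₂ g₁ g₂ => ?_) fun h hag h₁ h₂ g₁ g₂ =>
      (ENNReal.ofReal_le_ofReal e2).trans
        (hyes _ (fun v hv => (hq.fresh v hv).1) h hag h₁ h₂ g₁ g₂)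
    by_cases hQ' : Agrees (pattern x.1 x.2.2) (trace q c₁)
    · exact le_randProb_ask₁_of_agrees hA₁ hδ hδ1 hη (hne _) (hlen _) hc₁ hQ'
        (hyes _ fun v hv => (hq.fresh v hv).2)
    refine le_randProb_ask₁ (fun h₁ h₂ g₁ g₂ => ?_) fun h hag h₁ h₂ g₁ g₂ =>
      (ENNReal.ofReal_le_ofReal e2).trans
        (hyes _ (fun v hv => (hq.fresh v hv).2) h hag h₁ h₂ g₁ g₂)
    rw [agrees_pattern] at hQ hQ'
    refine (ENNReal.ofReal_le_ofReal (by linarith)).trans (ih S _ ?_ hcS ?_ hS)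
    · have : potential d B S (refute x.1 x.2.1 x.2.2 N) < potential d B S N := hq.progress
      omega
    · exact mem_filter.2 ⟨hcN, hQ, hQ'⟩

end Prob

end Procedure

/-! ### Drawing the sample -/

section Iterate

variable {X : Type*} [MeasurableSpace X]

/-- The iterated integral of `g` over `r` more points, when the points `p` have been drawn. -/
def iterIntegral (D : Measure X) (g : ∀ s, (Fin s → X) → ℝ≥0∞) : ℕ → ∀ s, (Fin s → X) → ℝ≥0∞
  | 0, s, p => g s p
  | r + 1, s, p => ∫⁻ x, iterIntegral D g r (s + 1) (Fin.snoc (α := fun _ => X) p x) ∂D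

lemma measurable_snoc {s : ℕ} :
    Measurable fun z : (Fin s → X) × X =>
      (Fin.snoc (α := fun _ => X) z.1 z.2 : Fin (s + 1) → X) := by
  refine measurable_pi_lambda _ fun i => ?_
  refine Fin.lastCases ?_ (fun j => ?_) i
  · simpa using measurable_snd
  · simp only [Fin.snoc_castSucc]
    exact (measurable_pi_apply j).comp measurable_fst

lemma measurable_iterIntegral (D : Measure X) [IsProbabilityMeasure D]
    {g : ∀ s, (Fin s → X) → ℝ≥0∞} (hg : ∀ s, Measurable (g s)) (r s : ℕ) :
    Measurable (iterIntegral D g r s) := by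
  induction r generalizing s with
  | zero => exact hg s
  | succ r ih => exact Measurable.lintegral_prod_right' ((ih (s + 1)).comp measurable_snoc)

lemma lintegral_pi_succ (D : Measure X) [IsProbabilityMeasure D] {s : ℕ}
    {f : (Fin (s + 1) → X) → ℝ≥0∞} (hf : Measurable f) :
    ∫⁻ p, f p ∂Measure.pi (fun _ => D) =
      ∫⁻ p, ∫⁻ x, f (Fin.snoc (α := fun _ => X) p x) ∂D ∂Measure.pi (fun _ : Fin s => D) := by
  have h := (measurePreserving_piFinSuccAbove (fun _ : Fin (s + 1) => D) (Fin.last s)).symm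
  rw [← h.lintegral_comp hf]
  refine (lintegral_prod_symm' _ (hf.comp h.measurable)).trans ?_
  refine lintegral_congr fun p => lintegral_congr fun x => ?_
  exact congrArg f (Fin.insertNth_last' x p)

lemma lintegral_iterIntegral (D : Measure X) [IsProbabilityMeasure D]
    {g : ∀ s, (Fin s → X) → ℝ≥0∞} (hg : ∀ s, Measurable (g s)) (r s n : ℕ) (h : s + r = n) :
    ∫⁻ p, iterIntegral D g r s p ∂Measure.pi (fun _ => D) =
      ∫⁻ p, g n p ∂Measure.pi (fun _ => D) := by
  induction r generalizing s with
  | zero =>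
    obtain rfl : s = n := h
    rfl
  | succ r ih =>
    rw [← ih (s + 1) (by omega), lintegral_pi_succ D (measurable_iterIntegral D hg r (s + 1))]
    rfl

end Iterate

namespace Procedure

section Draw

variable {X₁ X₂ : Type*} {C₁ : Set (Set X₁)} {C₂ : Set (Set X₂)}
  {A₁ : ℝ → ℝ → Learner X₁ C₁} {A₂ : ℝ → ℝ → Learner X₂ C₂}
  {g₁ : Fin 0 → C₁} {g₂ : Fin 0 → C₂} {d B n : ℕ} {ε δ : ℝ}

lemma snoc_label_iff {s : ℕ} {lab : Fin s → Bool} {p : Fin s → X₁ × X₂} {c : Set (X₁ × X₂)}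
    (h : ∀ j, lab j = true ↔ p j ∈ c) (x : X₁ × X₂) (j : Fin (s + 1)) :
    Fin.snoc (α := fun _ => Bool) lab (decide (x ∈ c)) j = true ↔
      Fin.snoc (α := fun _ => X₁ × X₂) p x j ∈ c := by
  refine Fin.lastCases ?_ (fun i => ?_) j
  · simp
  · simpa using h i

lemma le_successProbOn_drawAll {x : ℕ → X₁ × X₂} {c : Set (X₁ × X₂)}
    {G : ℕ → prodClass C₁ C₂ → Prop} {ρ : ℝ≥0∞}
    (h : ∀ (lab : Fin n → Bool), (∀ j, lab j = true ↔ x j ∈ c) →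
      ρ ≤ ((search d B ε δ lab (3 * B) ∅ univ 0 0).toLearner A₁ A₂ (fun j => x j)
        g₁ g₂).randProb (G n))
    (r s : ℕ) (hr : s + r = n) (lab : Fin s → Bool) (p : Fin s → X₁ × X₂) (hp : ∀ j, p j = x j)
    (hlab : ∀ j, lab j = true ↔ p j ∈ c) :
    ρ ≤ ((drawAll d B ε δ r lab).toLearner A₁ A₂ p g₁ g₂).successProbOn x c G s := by
  induction r generalizing s with
  | zero =>
    obtain rfl : s = n := hr
    obtain rfl : p = fun j : Fin s => x j := funext hp
    exact (h lab hlab).trans (Learner.randProb_le_successProbOn _ _ _ _ _)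
  | succ r ih =>
    simp only [drawAll, toLearner, Learner.successProbOn]
    refine ih (s + 1) (by omega) _ _ (fun j => ?_) fun j => snoc_label_iff hlab _ j
    refine Fin.lastCases ?_ (fun i => ?_) j
    · simp
    · simpa using hp i

lemma mul_iterIntegral_le_successProb [MeasurableSpace X₁] [MeasurableSpace X₂]
    {D : Measure (X₁ × X₂)} {c : Set (X₁ × X₂)} {G : prodClass C₁ C₂ → Prop} {ρ : ℝ≥0∞}
    (hρ : ρ ≠ ⊤) {g : ∀ s, (Fin s → X₁ × X₂) → ℝ≥0∞}
    (h : ∀ (lab : Fin n → Bool) (p : Fin n → X₁ × X₂), (∀ j, lab j = true ↔ p j ∈ c) →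
      ρ * g n p ≤ ((search d B ε δ lab (3 * B) ∅ univ 0 0).toLearner A₁ A₂ p
        g₁ g₂).randProb G)
    (r s : ℕ) (hr : s + r = n) (lab : Fin s → Bool) (p : Fin s → X₁ × X₂)
    (hlab : ∀ j, lab j = true ↔ p j ∈ c) :
    ρ * iterIntegral D g r s p ≤
      ((drawAll d B ε δ r lab).toLearner A₁ A₂ p g₁ g₂).successProb D c G := by
  induction r generalizing s with
  | zero =>
    obtain rfl : s = n := hr
    exact (h lab p hlab).trans (Learner.randProb_le_successProb _ _ _ _)
  | succ r ih =>
    simp only [drawAll, toLearner, Learner.successProb, iterIntegral]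
    rw [← lintegral_const_mul' _ _ hρ]
    exact lintegral_mono fun x => ih (s + 1) (by omega) _ _ fun j => snoc_label_iff hlab _ j

/-- If the search succeeds with probability `ρ` for all samples outside `E`, then the procedure
succeeds with probability at least `ρ (1 - D(E))`. -/
lemma mul_measure_compl_le_successProb [MeasurableSpace X₁] [MeasurableSpace X₂]
    {D : Measure (X₁ × X₂)} [IsProbabilityMeasure D] {c : Set (X₁ × X₂)}
    {G : prodClass C₁ C₂ → Prop} {ρ : ℝ≥0∞} (hρ : ρ ≠ ⊤) {E : Set (Fin n → X₁ × X₂)}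
    (hE : MeasurableSet E)
    (h : ∀ (lab : Fin n → Bool), ∀ p ∉ E, (∀ j, lab j = true ↔ p j ∈ c) →
      ρ ≤ ((search d B ε δ lab (3 * B) ∅ univ 0 0).toLearner A₁ A₂ p g₁ g₂).randProb G)
    (lab : Fin 0 → Bool) (p : Fin 0 → X₁ × X₂) :
    ρ * Measure.pi (fun _ => D) Eᶜ ≤
      ((drawAll d B ε δ n lab).toLearner A₁ A₂ p g₁ g₂).successProb D c G := by
  let g : ∀ s, (Fin s → X₁ × X₂) → ℝ≥0∞ := fun s q =>
    if hs : n = s then Eᶜ.indicator 1 fun i => q (Fin.cast hs i) else 0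
  have hgn : g n = Eᶜ.indicator 1 := by
    funext q
    simp [g]
  have hg : ∀ s, Measurable (g s) := fun s => by
    by_cases hs : n = s
    · subst hs
      rw [hgn]
      exact measurable_one.indicator hE.compl
    · simp only [g, hs, dif_neg, not_false_eq_true]
      exact measurable_const
  refine le_trans ?_ (mul_iterIntegral_le_successProb (D := D) hρ (g := g) (fun lab q hq => ?_)
    n 0 (Nat.zero_add n) lab p fun j => j.elim0)
  · gcongr
    calc Measure.pi (fun _ => D) Eᶜ = ∫⁻ q, g n q ∂Measure.pi (fun _ => D) := by
          rw [hgn, lintegral_indicator_one hE.compl]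
      _ = ∫⁻ q, iterIntegral D g n 0 q ∂Measure.pi (fun _ => D) :=
          (lintegral_iterIntegral D hg n 0 n (Nat.zero_add n)).symm
      _ ≤ iterIntegral D g n 0 p := by
          rw [Measure.pi_of_empty (fun _ : Fin 0 => D) p]
          exact Learner.lintegral_dirac_le _ _
  · rw [hgn]
    by_cases hqE : q ∈ E
    · simp [hqE]
    · rw [Set.indicator_of_mem (by exact hqE)]
      simpa using h lab q hqE hq

end Draw

end Procedure

/-! ### The bounds -/

lemma le_sampleSize_sub_one {d₁ d₂ : ℕ} {ε δ : ℝ} (hε : 0 < ε) (hε1 : ε < 1) (hδ : 0 < δ)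
    (hδ1 : δ < 1) {m : ℕ} (hm : m = sampleSize 120 d₁ d₂ ε δ) :
    2 ≤ m ∧ 60 * ((d₁ + d₂ : ℝ) * Real.log (2 / ε) + Real.log (2 / δ)) / ε ≤ (m - 1 : ℕ) := by
  have hl2 := Real.log_two_gt_d9
  have hlε : Real.log 2 ≤ Real.log (2 / ε) :=
    Real.log_le_log (by norm_num) (by rw [le_div_iff₀ hε]; linarith)
  have hlδ : Real.log 2 ≤ Real.log (2 / δ) :=
    Real.log_le_log (by norm_num) (by rw [le_div_iff₀ hδ]; linarith)
  have hL : (0.6 : ℝ) ≤ (d₁ + d₂ : ℝ) * Real.log (2 / ε) + Real.log (2 / δ) := by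
    have : (0 : ℝ) ≤ (d₁ + d₂ : ℝ) * Real.log (2 / ε) :=
      mul_nonneg (by positivity) (by linarith)
    linarith
  have hceil := Nat.le_ceil (120 * ((d₁ + d₂ : ℝ) * Real.log (2 / ε) + Real.log (2 / δ)) / ε)
  rw [← sampleSize, ← hm] at hceil
  set L := (d₁ + d₂ : ℝ) * Real.log (2 / ε) + Real.log (2 / δ)
  have hLε : L ≤ L / ε := by rw [le_div_iff₀ hε]; nlinarith
  rw [mul_div_assoc] at hceil ⊢
  have hm2 : (2 : ℝ) ≤ m := by linarith
  have hm2' : 2 ≤ m := by exact_mod_cast hm2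
  refine ⟨hm2', ?_⟩
  rw [Nat.cast_sub (by omega), Nat.cast_one]
  linarith

/-- If the class shatters two points or has three traces on some points, then it has two concepts
to which `IsPACLearner.le_time` applies. -/
lemma exists_agree_differ {X ι : Type*} [Fintype ι] {q : ι → X} {C : Set (Set X)} {d : ℕ}
    (hd : vcDim C = d) (h : 2 ≤ d ∨ 2 < #(traces q C)) :
    ∃ c ∈ C, ∃ c' ∈ C, ∃ y z, (y ∈ c ↔ y ∈ c') ∧ ¬ (z ∈ c ↔ z ∈ c') := by
  rcases h with h | h
  · obtain ⟨S, hS, hcard⟩ : ∃ S : Finset X, Shatters C S ∧ 1 < S.card := by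
      by_contra! hcon
      have : vcDim C ≤ 1 := iSup_le fun S => by exact_mod_cast hcon S.1 S.2
      rw [hd] at this
      have : d ≤ 1 := by exact_mod_cast this
      omega
    obtain ⟨y, hy, z, hz, hyz⟩ := one_lt_card.1 hcard
    obtain ⟨c, hc, hSc⟩ := hS S subset_rfl
    obtain ⟨c', hc', hSc'⟩ := hS {y} (by simpa using hy)
    refine ⟨c, hc, c', hc', y, z, ?_, ?_⟩
    · have h1 : y ∈ (S : Set X) ∩ c := by rw [hSc]; exact hy
      have h2 : y ∈ (S : Set X) ∩ c' := by rw [hSc']; rfl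
      exact ⟨fun _ => h2.2, fun _ => h1.2⟩
    · have h1 : z ∈ (S : Set X) ∩ c := by rw [hSc]; exact hz
      intro hiff
      have h2 : z ∈ (S : Set X) ∩ c' := ⟨hz, hiff.1 h1.2⟩
      rw [hSc'] at h2
      exact hyz h2.symm
  · obtain ⟨t₁, ht₁, t₂, ht₂, t₃, ht₃, h12, h13, h23⟩ := two_lt_card.1 h
    obtain ⟨c₁, hc₁, rfl⟩ := mem_traces.1 ht₁
    obtain ⟨c₂, hc₂, rfl⟩ := mem_traces.1 ht₂
    obtain ⟨c₃, hc₃, rfl⟩ := mem_traces.1 ht₃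
    by_contra! hcon
    have key : ∀ c ∈ C, ∀ c' ∈ C, trace q c ≠ trace q c' → ∀ i, ¬ (q i ∈ c ↔ q i ∈ c') := by
      intro c hc c' hc' hne i hi
      exact hne (Finset.ext fun j => by simpa using hcon c hc c' hc' (q i) (q j) hi)
    have hι : Nonempty ι := by
      by_contra hem
      rw [not_nonempty_iff] at hem
      exact h12 (Finset.ext fun i => isEmptyElim i)
    have i := hι.some
    have k12 := key _ hc₁ _ hc₂ h12 i
    have k13 := key _ hc₁ _ hc₃ h13 i
    have k23 := key _ hc₂ _ hc₃ h23 i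
    tauto

/-- The arithmetic of the running time. Either a call of the first sublearner takes at least `m / 4`
steps, or the queries have size at most two and there are at most two traces. -/
lemma search_time_le {B m F ℓ : ℕ} {t₁ t₂ : ℕ∞} (hm : 1 ≤ m) (hmB : m ≤ B) (hF : F ≤ B)
    (ht₁ : 1 ≤ t₁) (ht₂ : 1 ≤ t₂)
    (h : ((m : ℕ∞) ≤ 4 * t₁ ∧ ℓ ≤ m) ∨ (ℓ ≤ 2 ∧ F ≤ 2)) :
    ((3 * B : ℕ) : ℕ∞) * (4 * ℓ + 2 * t₁) + F * (5 * ((m - 1 : ℕ) : ℕ∞) + 2 * t₂) + 1 ≤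
      (99 : ℕ) * B * (t₁ + t₂) := by
  have hB : (B : ℕ∞) ≠ 0 := by
    have : B ≠ 0 := by omega
    exact_mod_cast this
  induction t₁ using ENat.recTopCoe with
  | top => simp [ENat.mul_top, hB]
  | coe t₁ =>
    induction t₂ using ENat.recTopCoe with
    | top => simp [ENat.mul_top, hB]
    | coe t₂ =>
      norm_cast at *
      have hBt₁ : B ≤ B * t₁ := Nat.le_mul_of_pos_right _ ht₁
      have hBt₂ : B ≤ B * t₂ := Nat.le_mul_of_pos_right _ ht₂
      have hFt₂ : F * t₂ ≤ B * t₂ := Nat.mul_le_mul_right _ hF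
      have ht₁B : t₁ ≤ B * t₁ := Nat.le_mul_of_pos_left _ (by omega)
      rcases h with ⟨h, hℓ⟩ | ⟨hℓ, hF2⟩
      · have h1 : B * ℓ ≤ B * (4 * t₁) := Nat.mul_le_mul_left _ (hℓ.trans h)
        have h2 : F * (m - 1) ≤ B * (4 * t₁) := Nat.mul_le_mul hF (by omega)
        nlinarith
      · have h1 : B * ℓ ≤ B * 2 := Nat.mul_le_mul_left _ hℓ
        have h2 : F * (m - 1) ≤ 2 * B := Nat.mul_le_mul hF2 (by omega)
        nlinarith

/-- The procedure for the sample size `m = sampleSize 120 d₁ d₂ ε δ`. One example less than `m` is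
drawn: a hypothesis with error at most `1 / m` on a uniform distribution over fewer than `m`
examples is right on all of them. -/
def modularLearner (d₁ d₂ : ℕ) (ε δ : ℝ) : Procedure 0 0 0 :=
  Procedure.drawAll d₁ (sampleSize 120 d₁ d₂ ε δ ^ max d₁ 1)
    (1 / (sampleSize 120 d₁ d₂ ε δ : ℝ))
    (δ / ((100 : ℕ) * (sampleSize 120 d₁ d₂ ε δ : ℝ) ^ max d₁ 1))
    (sampleSize 120 d₁ d₂ ε δ - 1) Fin.elim0

lemma draws_modularLearner_le {X₁ X₂ : Type*} {C₁ : Set (Set X₁)} {C₂ : Set (Set X₂)}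
    (d₁ d₂ : ℕ) (A₁ : ℝ → ℝ → Learner X₁ C₁) (A₂ : ℝ → ℝ → Learner X₂ C₂) (ε δ : ℝ) :
    (combine (modularLearner d₁ d₂) A₁ A₂ ε δ).draws ≤ (sampleSize 120 d₁ d₂ ε δ : ℕ∞) :=
  (Procedure.draws_drawAll_le _ _ _ _ _ _).trans (by exact_mod_cast Nat.sub_le _ _)

section Main

variable {X₁ X₂ : Type*} [MeasurableSpace X₁] {C₁ : Set (Set X₁)} {C₂ : Set (Set X₂)} {d₁ d₂ : ℕ}
  {A₁ : ℝ → ℝ → Learner X₁ C₁} {A₂ : ℝ → ℝ → Learner X₂ C₂} {ε δ : ℝ}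

lemma sauer_le_pow_max {m d : ℕ} (hm : 2 ≤ m) : sauer d (m - 1) ≤ m ^ max d 1 := by
  refine (sauer_le_pow _ _).trans ?_
  rw [Nat.sub_add_cancel (by omega)]
  exact Nat.pow_le_pow_right (by omega) (le_max_left _ _)

lemma confidence_bounds (hδ : 0 < δ) (hδ1 : δ < 1) {m k : ℕ} (hm : 2 ≤ m) {δ' : ℝ}
    (hδ' : δ' = δ / ((100 : ℕ) * (m : ℝ) ^ k)) :
    0 < δ' ∧ δ' ≤ 1 / 4 ∧ 3 * ((3 * m ^ k : ℕ) : ℝ) * δ' ≤ δ / 2 := by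
  have hpow : (1 : ℝ) ≤ (m : ℝ) ^ k := one_le_pow₀ (by exact_mod_cast (by omega : 1 ≤ m))
  refine ⟨by rw [hδ']; positivity, ?_, ?_⟩
  · rw [hδ', div_le_iff₀ (by positivity)]
    push_cast
    linarith
  · rw [hδ']
    push_cast
    rw [mul_div_assoc', div_le_iff₀ (by positivity)]
    nlinarith

/-- Once the sample is drawn, the procedure finds a consistent product with high probability. -/
lemma le_randProb_search_sample [MeasurableSpace X₂] (hd₁ : vcDim C₁ = d₁)
    (hA₁ : IsPACLearner C₁ A₁) (hA₂ : IsPACLearner C₂ A₂) (hδ : 0 < δ) (hδ1 : δ < 1) {m : ℕ}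
    (hm : 2 ≤ m) {δ' : ℝ}
    (hδ' : δ' = δ / ((100 : ℕ) * (m : ℝ) ^ max d₁ 1)) {c : Set (X₁ × X₂)}
    (hc : c ∈ prodClass C₁ C₂) {lab : Fin (m - 1) → Bool} {p : Fin (m - 1) → X₁ × X₂}
    (hlab : ∀ j, lab j = true ↔ p j ∈ c) {G : prodClass C₁ C₂ → Prop}
    (hG : ∀ h : prodClass C₁ C₂, (∀ j, p j ∈ h.1 ↔ p j ∈ c) → G h)
    {g₁ : Fin 0 → C₁} {g₂ : Fin 0 → C₂} :
    ENNReal.ofReal (1 - δ / 2) ≤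
      ((Procedure.search d₁ (m ^ max d₁ 1) (1 / m) δ' lab (3 * m ^ max d₁ 1) ∅ univ 0 0).toLearner
        A₁ A₂ p g₁ g₂).randProb G := by
  obtain ⟨c₁, hc₁, c₂, hc₂, rfl⟩ := hc
  obtain ⟨h0, h1, h2⟩ := confidence_bounds hδ hδ1 hm hδ'
  refine (ENNReal.ofReal_le_ofReal ?_).trans (Procedure.le_randProb_search hA₁ hA₂ h0
    (by linarith) (by omega) (by omega) hd₁.le (sauer_le_pow_max hm) hc₁ hc₂ hlab
    (fun h hh => hG h fun j => (hh j).trans (hlab j)) _ _ _ (by simp) (by simp) (by simp)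
    (potential_le _ _ _ _))
  linarith

lemma isPACLearner_modularLearner [MeasurableSpace X₂] (hC₁ : WellBehaved C₁)
    (hC₂ : WellBehaved C₂) (hd₁ : vcDim C₁ = d₁) (hd₂ : vcDim C₂ = d₂) (hA₁ : IsPACLearner C₁ A₁)
    (hA₂ : IsPACLearner C₂ A₂) :
    IsPACLearner (prodClass C₁ C₂) (combine (modularLearner d₁ d₂) A₁ A₂) := by
  intro ε δ hε hε1 hδ hδ1 D hD c hc
  obtain ⟨hm, hn⟩ := le_sampleSize_sub_one hε hε1 hδ hδ1 (rfl : _ = sampleSize 120 d₁ d₂ ε δ)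
  obtain ⟨E, hE, hDE, hgood⟩ :=
    exists_measurable_bad_le hC₁ hC₂ hd₁.le hd₂.le D hc hε hε1 hδ hδ1 hn
  refine le_trans ?_ (Procedure.mul_measure_compl_le_successProb (ρ := ENNReal.ofReal (1 - δ / 2))
    ENNReal.ofReal_ne_top hE (fun lab p hp hlab => ?_) _ _)
  · rw [prob_compl_eq_one_sub hE]
    calc ENNReal.ofReal (1 - δ) ≤ ENNReal.ofReal ((1 - δ / 2) * (1 - δ / 2)) :=
          ENNReal.ofReal_le_ofReal (by nlinarith)
      _ = ENNReal.ofReal (1 - δ / 2) * (1 - ENNReal.ofReal (δ / 2)) := by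
          rw [ENNReal.ofReal_mul (by linarith), ENNReal.ofReal_sub 1 (by positivity),
            ENNReal.ofReal_one]
      _ ≤ _ := by gcongr
  · exact le_randProb_search_sample hd₁ hA₁ hA₂ hδ hδ1 hm rfl hc hlab
      fun h hh => hgood p hp h.1 h.2 hh

lemma isERM_modularLearner [MeasurableSpace X₂] (hd₁ : vcDim C₁ = d₁)
    (hA₁ : IsPACLearner C₁ A₁) (hA₂ : IsPACLearner C₂ A₂) :
    IsERM (prodClass C₁ C₂) (combine (modularLearner d₁ d₂) A₁ A₂) := by
  intro ε δ hε hε1 hδ hδ1 x c hc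
  obtain ⟨hm, -⟩ := le_sampleSize_sub_one hε hε1 hδ hδ1 (rfl : _ = sampleSize 120 d₁ d₂ ε δ)
  refine (ENNReal.ofReal_le_ofReal (by linarith : 1 - δ ≤ 1 - δ / 2)).trans
    (Procedure.le_successProbOn_drawAll (fun lab hlab => ?_) _ 0 (Nat.zero_add _) _ _
      (fun j => j.elim0) fun j => j.elim0)
  exact le_randProb_search_sample hd₁ hA₁ hA₂ hδ hδ1 hm rfl hc hlab
    fun h hh i hi => hh ⟨i, hi⟩

lemma time_modularLearner_le (hd₁ : vcDim C₁ = d₁) (hA₁ : IsPACLearner C₁ A₁) (hε : 0 < ε)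
    (hε1 : ε < 1) (hδ : 0 < δ) (hδ1 : δ < 1) {m : ℕ} (hm : m = sampleSize 120 d₁ d₂ ε δ) {δ' : ℝ}
    (hδ' : δ' = δ / ((100 : ℕ) * (m : ℝ) ^ max d₁ 1)) :
    (combine (modularLearner d₁ d₂) A₁ A₂ ε δ).time ≤
      (100 : ℕ) * (m : ℕ∞) ^ max d₁ 1 *
        ((A₁ (1 / (m : ℝ)) δ').time + (A₂ (1 / (m : ℝ)) δ').time) := by
  obtain ⟨hm2, -⟩ := le_sampleSize_sub_one hε hε1 hδ hδ1 hm
  obtain ⟨h0, h1, -⟩ := confidence_bounds hδ hδ1 hm2 hδ'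
  have hmB : m ≤ m ^ max d₁ 1 := Nat.le_self_pow (by have := le_max_right d₁ 1; omega) m
  rw [← Nat.cast_pow, combine, modularLearner, ← hm, ← hδ']
  set B := m ^ max d₁ 1
  set t₁ := (A₁ (1 / (m : ℝ)) δ').time
  set t₂ := (A₂ (1 / (m : ℝ)) δ').time
  have ht₁ : 1 ≤ t₁ := Learner.one_le_time _
  have ht₂ : 1 ≤ t₂ := Learner.one_le_time _
  have hdraws : ((m - 1 : ℕ) : ℕ∞) ≤ B * (t₁ + t₂) :=
    calc ((m - 1 : ℕ) : ℕ∞) ≤ B := by exact_mod_cast (Nat.sub_le _ _).trans hmB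
      _ ≤ B * (t₁ + t₂) := le_mul_of_one_le_right zero_le (ht₁.trans le_self_add)
  refine (Procedure.time_drawAll_le (t := (99 : ℕ) * B * (t₁ + t₂)) (fun lab p g₁ g₂ => ?_) _ 0
    (Nat.zero_add _) _ _ _ _).trans ((add_le_add hdraws le_rfl).trans (le_of_eq ?_))
  · set F := traces (fun j => (p j).1) C₁
    have hF : F.card ≤ B := (card_traces_le _ hd₁.le).trans
      (by rw [Fintype.card_fin]; exact sauer_le_pow_max hm2)
    by_cases hdeg : 2 ≤ d₁ ∨ 2 < F.card
    · obtain ⟨c, hc, c', hc', y, z, hy, hz⟩ := exists_agree_differ hd₁ hdeg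
      have htime := hA₁.le_time hc hc' hy hz hm2 h0 h1
      refine (Procedure.time_search_le (ℓ := m - 1) (fun S _ N => ?_) _ _ _
        (empty_subset _)).trans ?_
      · exact (card_le_univ _).trans (by simp)
      · rw [sdiff_empty]
        exact search_time_le (by omega) hmB hF ht₁ ht₂ (Or.inl ⟨htime, Nat.sub_le _ _⟩)
    · rw [not_or, not_le, not_lt] at hdeg
      refine (Procedure.time_search_le (ℓ := 2) (fun S hS N => ?_) _ _ _
        (empty_subset _)).trans ?_
      · have := card_nextQuery_le d₁ B S N
        have : S.card ≤ F.card := card_le_card hS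
        omega
      · rw [sdiff_empty]
        exact search_time_le (by omega) hmB hF ht₁ ht₂ (Or.inr ⟨le_rfl, hdeg.2⟩)
  · push_cast
    ring

end Main

end ModularPAC

end

theorem mainTheorem10 :
    ∃ (b : ℝ) (K : ℕ), 0 < b ∧ 0 < K ∧
      ∃ P : ℕ → ℕ → ℝ → ℝ → ModularPAC.Procedure 0 0 0,
        ∀ (X₁ : Type*) (X₂ : Type*) [MeasurableSpace X₁] [MeasurableSpace X₂]
          (C₁ : Set (Set X₁)) (C₂ : Set (Set X₂)) (d₁ d₂ : ℕ),
          ModularPAC.WellBehaved C₁ → ModularPAC.WellBehaved C₂ →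
          ModularPAC.vcDim C₁ = d₁ → ModularPAC.vcDim C₂ = d₂ →
          ∀ (A₁ : ℝ → ℝ → ModularPAC.Learner X₁ C₁) (A₂ : ℝ → ℝ → ModularPAC.Learner X₂ C₂),
            ModularPAC.IsPACLearner C₁ A₁ → ModularPAC.IsPACLearner C₂ A₂ →
            ModularPAC.IsPACLearner (ModularPAC.prodClass C₁ C₂)
              (ModularPAC.combine (P d₁ d₂) A₁ A₂) ∧
            ModularPAC.IsERM (ModularPAC.prodClass C₁ C₂)
              (ModularPAC.combine (P d₁ d₂) A₁ A₂) ∧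
            ∀ ε δ : ℝ, 0 < ε → ε < 1 → 0 < δ → δ < 1 →
              ∀ m : ℕ, m = ModularPAC.sampleSize b d₁ d₂ ε δ →
              ∀ δ' : ℝ, δ' = δ / ((K : ℝ) * (m : ℝ) ^ max d₁ 1) →
                (ModularPAC.combine (P d₁ d₂) A₁ A₂ ε δ).draws ≤ (m : ℕ∞) ∧
                (ModularPAC.combine (P d₁ d₂) A₁ A₂ ε δ).time ≤
                  (K : ℕ∞) * (m : ℕ∞) ^ max d₁ 1 *
                    ((A₁ (1 / (m : ℝ)) δ').time + (A₂ (1 / (m : ℝ)) δ').time) := by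
  refine ⟨120, 100, by norm_num, by norm_num, ModularPAC.modularLearner, ?_⟩
  intro X₁ X₂ _ _ C₁ C₂ d₁ d₂ hC₁ hC₂ hd₁ hd₂ A₁ A₂ hA₁ hA₂
  refine ⟨ModularPAC.isPACLearner_modularLearner hC₁ hC₂ hd₁ hd₂ hA₁ hA₂,
    ModularPAC.isERM_modularLearner hd₁ hA₁ hA₂, fun ε δ hε hε1 hδ hδ1 m hm δ' hδ' => ⟨?_, ?_⟩⟩
  · rw [hm]
    exact ModularPAC.draws_modularLearner_le d₁ d₂ A₁ A₂ ε δ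
  · exact ModularPAC.time_modularLearner_le hd₁ hA₁ hε hε1 hδ hδ1 hm hδ'
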